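/- **Setting.** Let $T>0$, $I=[0,T]$, let $\mathbb P\subset\mathbb R^{d}$ ($d=d_\mu$) be a bounded set of time-constant parameters, and let $u_h(t;\mu)\in\mathbb R^{N_h}$, $(t,\mu)\in I\times\mathbb P$, be the (scalar-valued) discrete solution on the $N_h$ nodes of a mesh with connectivity graph $G$. The initial condition is fixed: $u_h(0;\mu)=u_0$ for all $\mu\in\mathbb P$. *Perfect embedding assumption.* For some $n^*\in\mathbb N$ and every $n\ge n^*$ there are a decoder $\Phi\in C^1(\mathbb R^n;\mathbb R^{N_h})$, an encoder $\Psi\in C^1(\mathbb R^{N_h};\mathbb R^n)$, a Lipschitz function $f_n:(0,T]\times\mathbb R^n\times\mathbb P\to\mathbb R^n$, and latent states $s(\cdot;\mu)\in C([0,T];\mathbb R^n)$ with, for all $\mu\in\mathbb P$ and $t\in(0,T]$, $$u_h(t;\mu)=\Phi(s(t;\mu)),\qquad \dot s(t;\mu)=f_n(t,s(t;\mu),\mu),\qquad s(0;\mu)=\Psi(u_h(0;\mu)).$$ *Networks.* A dynamics network $\mathcal{NN}_{\rm dyn}:\mathbb R^{d+1}\to\mathbb R^n$ is a fully connected feedforward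 network with activation $\tanh$ and affine output layer. A graph decoder $\mathcal{NN}_{\rm dec}:\mathbb R^n\to\mathbb R^{N_h}$ with $m$ convolution layers is a fully connected feedforward network $\mathbb R^n\to\mathbb R^{N_h}$ with affine output layer, followed by $m$ message-passing layers with skip connections, $h_v\mapsto h_v+\sigma\big(\frac1{|N(v)|}\sum_{w\in N(v)}Wh_w+b\big)$ with $W,b\in\mathbb R$, all with activation $\sigma=\mathrm{ELU}$. Active weights are the nonzero weights and biases. *Quadrature.* For $N\ge1$ put $\Delta t=T/N$, $t_j=j\Delta t$. A quadrature rule is a family of weights $\omega_j=\omega^{N,k}_j$, $0\le j\le k\le N$. It is convergent if for every continuous $g:[0,T]\to\mathbb R$ we have $\max_{1\le k\le N}\big|\Delta t\sum_{j=0}^k\omega_jg(t_j)-\int_0^{t_k}g\,dt\big|\to0$ as $N\to\infty$. *Constants.* Let $\nu$ be a norm (or seminorm) on $\mathbb R^{N_h}$. Consider constants $K,R,L,\kappa$ such that, for some embedding as above of latent dimension $n^*$, $f_{n^*}$ is $K$-Lipschitz, $\|s(t;\mu)\|_\infty\le R$ on $[0,T]\times\mathbb P$, and $\Phi$ is $L$-Lipschitz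 on $\{\|x\|_\infty\le R+1\}$ (for maximum norms), and $\nu(x)\le\kappa\|x\|_\infty$ for all $x\in\mathbb R^{N_h}$. **Corollary (UAT for encoder-free architectures).** Given $d,T,\mathbb P,n^*$, there is a function $C=C(K,R,L,\kappa)$ such that the following holds for all $N_h$, $G$, $u_h$ and $\nu$ for which the initial condition is fixed and the perfect embedding assumption holds. Constants $K,R,L,\kappa$ as above exist; and for any such constants, every $n\ge n^*$, every number $m\ge 0$ of convolution layers and every $\varepsilon>0$ there exist 1. a dynamics network $\mathcal{NN}_{\rm dyn}$ with at most $C\,n\max\{1,\varepsilon^{-(d+1)}\}$ active weights, 2. a graph decoder $\mathcal{NN}_{\rm dec}$ with $m$ convolution layers and at most $C\,N_h\max\{1,\varepsilon^{-n}\}$ active weights, 3. for each convergent quadrature rule, a $\Delta t^*>0$, such that for all step sizes $\Delta t=T/N\le\Delta t^*$ and all $\mu\in\mathbb P$ $$\max_{1\le k\le N}\nu\big(u_h(t_k;\mu)-u_{\rm sim}(t_k;\mu)\big)\le\varepsilon,\qquad u_{\rm sim}(t_k;\mu)=\mathcal{NN}_{\rm dec}\Big(\Delta t\sum_{j=0}^k\omega_j\,\mathcal{NN}_{\rm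 dyn}(t_j,\mu)\Big).$$ In particular, the constant $C$ does not depend on $\varepsilon$, $n$ or $m$, and depends on the discrete problem only through $K,R,L,\kappa$. -/

import Mathlib

open Set Filter Topology
open scoped NNReal

noncomputable section

/-! ### Neural networks -/

/-- The exponential linear unit (with parameter `1`). -/
def elu (x : ℝ) : ℝ := if 0 ≤ x then x else Real.exp x - 1

/-- Number of nonzero entries of a matrix. -/
def nnzMatrix {α β : Type} [Fintype α] [Fintype β] (W : Matrix α β ℝ) : ℕ :=
  {p : α × β | W p.1 p.2 ≠ 0}.ncard

/-- Number of nonzero entries of a vector. -/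
def nnzVec {α : Type} [Fintype α] (b : α → ℝ) : ℕ :=
  {i : α | b i ≠ 0}.ncard

/-- The weights and biases of a fully connected feedforward network `ℝ^a → ℝ^κ`:
finitely many hidden layers of arbitrary widths, followed by an affine output layer. -/
inductive FNN (κ : Type) : ℕ → Type
  | output {a : ℕ} (W : Matrix κ (Fin a) ℝ) (b : κ → ℝ) : FNN κ a
  | hidden {a k : ℕ} (W : Matrix (Fin k) (Fin a) ℝ) (b : Fin k → ℝ) (next : FNN κ k) : FNN κ a

/-- The function realized by a network; the activation `σ` acts componentwise after every
hidden layer. -/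
def FNN.eval {κ : Type} (σ : ℝ → ℝ) : {a : ℕ} → FNN κ a → (Fin a → ℝ) → κ → ℝ
  | _, .output W b, x => fun i => W.mulVec x i + b i
  | _, .hidden W b next, x => next.eval σ (fun i => σ (W.mulVec x i + b i))

/-- The number of active (nonzero) weights and biases. -/
def FNN.activeWeights {κ : Type} [Fintype κ] : {a : ℕ} → FNN κ a → ℕ
  | _, .output W b => nnzMatrix W + nnzVec b
  | _, .hidden W b next => nnzMatrix W + nnzVec b + next.activeWeights

/-- The weights of a graph convolution (message-passing) layer with `c` features per node. -/
structure GraphConv (c : ℕ) where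
  W : Matrix (Fin c) (Fin c) ℝ
  b : Fin c → ℝ

/-- A graph convolution layer with skip connection: the features `h_v` of the node `v` become
`h_v + σ ((1 / |N(v)|) ∑_{w ∈ N(v)} W h_w + b)`. -/
def GraphConv.apply {V : Type} [Fintype V] (G : SimpleGraph V) [DecidableRel G.Adj]
    (σ : ℝ → ℝ) {c : ℕ} (l : GraphConv c) (h : V → Fin c → ℝ) : V → Fin c → ℝ :=
  fun v i => h v i +
    σ ((1 / (G.degree v : ℝ)) * (∑ w ∈ G.neighborFinset v, l.W.mulVec (h w) i) + l.b i)

def GraphConv.activeWeights {c : ℕ} (l : GraphConv c) : ℕ := nnzMatrix l.W + nnzVec l.b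

/-- A graph decoder from the latent space `ℝ^n` to functions with `c` features on the nodes `V`:
a fully connected network, followed by a sequence of graph convolution layers. -/
structure GraphDecoder (n : ℕ) (V : Type) (c : ℕ) where
  fc : FNN (V × Fin c) n
  convs : List (GraphConv c)

def GraphDecoder.eval {n : ℕ} {V : Type} [Fintype V] {c : ℕ} (G : SimpleGraph V)
    [DecidableRel G.Adj] (σ : ℝ → ℝ) (D : GraphDecoder n V c) (x : Fin n → ℝ) : V → Fin c → ℝ :=
  D.convs.foldl (fun h l => l.apply G σ h) (fun v i => D.fc.eval σ x (v, i))

def GraphDecoder.activeWeights {n : ℕ} {V : Type} [Fintype V] {c : ℕ}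
    (D : GraphDecoder n V c) : ℕ :=
  D.fc.activeWeights + (D.convs.map GraphConv.activeWeights).sum

/-! ### Quadrature in time

A quadrature rule is given by its weights `ω N k j`, `0 ≤ j ≤ k ≤ N`: on the uniform grid
`t_j = j T / N`, the integral of `g` over `[0, t_k]` is replaced by
`Δt ∑_{j ≤ k} ω N k j g(t_j)` with `Δt = T / N`. -/

def quadrature (T : ℝ) (ω : ℕ → ℕ → ℕ → ℝ) (N k : ℕ) (g : ℝ → ℝ) : ℝ :=
  (T / N) * ∑ j ∈ Finset.range (k + 1), ω N k j * g (j * (T / N))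

/-- The rule converges on `[0, T]`, uniformly in the upper grid point, for every continuous
integrand. -/
def IsConvergentQuadrature (T : ℝ) (ω : ℕ → ℕ → ℕ → ℝ) : Prop :=
  ∀ g : ℝ → ℝ, ContinuousOn g (Icc 0 T) → ∀ η > 0, ∀ᶠ N : ℕ in atTop,
    ∀ k : ℕ, 1 ≤ k → k ≤ N →
      |quadrature T ω N k g - ∫ t in (0 : ℝ)..(k * (T / N)), g t| ≤ η

/-- The latent state `s(t_k; μ) = Δt ∑_{j ≤ k} ω_j NN_dyn(t_j, μ)`, where the dynamics network
takes the input `(t, μ) ∈ ℝ^{d+1}` and has activation `tanh`. -/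
def latentState {d n : ℕ} (T : ℝ) (ω : ℕ → ℕ → ℕ → ℝ) (dyn : FNN (Fin n) (d + 1))
    (N k : ℕ) (μ : Fin d → ℝ) : Fin n → ℝ :=
  fun i => quadrature T ω N k (fun t => dyn.eval Real.tanh (Matrix.vecCons t μ) i)

/-! ### The perfect embedding assumption -/

/-- The latent vector field as a function on `(0, T] × ℝ^n × P`, with the maximum norm. -/
def LipschitzField {d n : ℕ} (T : ℝ) (P : Set (Fin d → ℝ)) (K : ℝ≥0)
    (f : ℝ → (Fin n → ℝ) → (Fin d → ℝ) → (Fin n → ℝ)) : Prop :=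
  LipschitzOnWith K (fun p : ℝ × (Fin n → ℝ) × (Fin d → ℝ) => f p.1 p.2.1 p.2.2)
    (Ioc 0 T ×ˢ (univ ×ˢ P))

/-- `Φ` (decoder), `f` (latent vector field), `s` (latent state) and `Ψ` (encoder) embed the
discrete solution `u(t; μ) ∈ ℝ^{Nh}` into a dynamical system on the latent space `ℝ^n`. -/
structure IsLatentEmbedding {d Nh n : ℕ} (T : ℝ) (P : Set (Fin d → ℝ))
    (u : ℝ → (Fin d → ℝ) → (Fin Nh → ℝ))
    (Φ : (Fin n → ℝ) → (Fin Nh → ℝ)) (f : ℝ → (Fin n → ℝ) → (Fin d → ℝ) → (Fin n → ℝ))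
    (s : ℝ → (Fin d → ℝ) → (Fin n → ℝ)) (Ψ : (Fin Nh → ℝ) → (Fin n → ℝ)) : Prop where
  decoder_contDiff : ContDiff ℝ 1 Φ
  field_lipschitz : ∃ K : ℝ≥0, LipschitzField T P K f
  state_continuous : ∀ μ ∈ P, ContinuousOn (fun t => s t μ) (Icc 0 T)
  state_deriv : ∀ μ ∈ P, ∀ t ∈ Ioc 0 T,
    HasDerivWithinAt (fun τ => s τ μ) (f t (s t μ) μ) (Icc 0 T) t
  decode : ∀ μ ∈ P, ∀ t ∈ Ioc 0 T, u t μ = Φ (s t μ)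
  encoder_contDiff : ContDiff ℝ 1 Ψ
  encode : ∀ μ ∈ P, s 0 μ = Ψ (u 0 μ)

/-- The perfect embedding assumption, with smallest latent dimension `nstar`. -/
def PerfectEmbedding {d Nh : ℕ} (T : ℝ) (P : Set (Fin d → ℝ))
    (u : ℝ → (Fin d → ℝ) → (Fin Nh → ℝ)) (nstar : ℕ) : Prop :=
  ∀ n ≥ nstar, ∃ (Φ : (Fin n → ℝ) → (Fin Nh → ℝ))
    (f : ℝ → (Fin n → ℝ) → (Fin d → ℝ) → (Fin n → ℝ))
    (s : ℝ → (Fin d → ℝ) → (Fin n → ℝ)) (Ψ : (Fin Nh → ℝ) → (Fin n → ℝ)),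
    IsLatentEmbedding T P u Φ f s Ψ

/-- `u` has an embedding into the latent space `ℝ^n` with Lipschitz constant `K` of the vector
field, trajectories of norm at most `R`, and Lipschitz constant `L` of the decoder on the ball of
radius `R + 1` (all norms are maximum norms). -/
def EmbeddingBounds {d Nh : ℕ} (T : ℝ) (P : Set (Fin d → ℝ))
    (u : ℝ → (Fin d → ℝ) → (Fin Nh → ℝ)) (n : ℕ) (K : ℝ≥0) (R : ℝ) (L : ℝ≥0) : Prop :=
  ∃ (Φ : (Fin n → ℝ) → (Fin Nh → ℝ)) (f : ℝ → (Fin n → ℝ) → (Fin d → ℝ) → (Fin n → ℝ))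
    (s : ℝ → (Fin d → ℝ) → (Fin n → ℝ)) (Ψ : (Fin Nh → ℝ) → (Fin n → ℝ)),
    IsLatentEmbedding T P u Φ f s Ψ ∧ LipschitzField T P K f ∧
    (∀ μ ∈ P, ∀ t ∈ Icc 0 T, ‖s t μ‖ ≤ R) ∧
    LipschitzOnWith L Φ (Metric.closedBall 0 (R + 1))

end

/-! ### Networks and their sizes -/

/-! Because the initial condition is fixed, every latent trajectory starts at the same point `Ψ u₀`.
The latent state is Lipschitz in `μ` by Grönwall's inequality and in `t` because the velocity is
bounded, so the velocity is a Lipschitz function of `(t, μ)` alone (`exists_velocity`). Its time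
integral recovers the state up to the shift `Ψ u₀`, which the decoder absorbs
(`EmbeddingBounds.exists_decoder_velocity`). No encoder is needed; two Lipschitz maps and one
integral remain to be approximated.

For the maps, `FNN.exists_approx` averages grid values against a product partition of unity built
from differences of the sigmoids `exp (-exp (θ (x - c)))`. Products of such sigmoids are
exponentials of linear combinations of the `exp (θ x_m)`, so two hidden layers with activation `exp`
suffice, and for fixed dimension their size per output is of the order of the number of grid cells.
A single `tanh` or ELU neuron imitates `exp`, so changing the activation leaves the size unchanged.

For the integral, Banach–Steinhaus and compactness of the closure of `P` make the quadrature
converge uniformly in `μ` (`IsConvergentQuadrature.eventually_forall_le`).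

The constant is independent of `n` and `m` because only the embedding of dimension `nstar` is used:
surplus latent coordinates have target zero and are ignored by the decoder, and the convolution
layers have zero weights. -/

theorem nnzMatrix_le {α β : Type} [Fintype α] [Fintype β] (W : Matrix α β ℝ) :
    nnzMatrix W ≤ Fintype.card α * Fintype.card β := by
  rw [nnzMatrix, ← Fintype.card_prod, ← Nat.card_eq_fintype_card, ← Set.ncard_univ]
  exact Set.ncard_le_ncard (Set.subset_univ _)

theorem nnzVec_le {α : Type} [Fintype α] (b : α → ℝ) : nnzVec b ≤ Fintype.card α := by
  rw [nnzVec, ← Nat.card_eq_fintype_card, ← Set.ncard_univ]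
  exact Set.ncard_le_ncard (Set.subset_univ _)

theorem continuous_elu : Continuous elu := by
  refine continuous_id.if_le (by fun_prop) continuous_const continuous_id ?_
  intro x hx
  simp [← hx]

namespace FNN

/-- The total number of weights and biases, zero or not. -/
def size {κ : Type} [Fintype κ] : {a : ℕ} → FNN κ a → ℕ
  | a, .output _ _ => Fintype.card κ * a + Fintype.card κ
  | a, .hidden (k := k) _ _ next => k * a + k + next.size

theorem activeWeights_le_size {κ : Type} [Fintype κ] {a : ℕ} (N : FNN κ a) :
    N.activeWeights ≤ N.size := by
  induction N with
  | output W b => simpa [activeWeights, size] using add_le_add (nnzMatrix_le W) (nnzVec_le b)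
  | hidden W b next ih =>
    simpa [activeWeights, size] using add_le_add (add_le_add (nnzMatrix_le W) (nnzVec_le b)) ih

theorem continuous_mulVec_add {κ : Type} {a : ℕ} (W : Matrix κ (Fin a) ℝ) (b : κ → ℝ) (i : κ) :
    Continuous fun x => W.mulVec x i + b i :=
  ((continuous_apply i).comp (Continuous.matrix_mulVec continuous_const continuous_id)).add
    continuous_const

theorem continuous_eval {κ : Type} {σ : ℝ → ℝ} (hσ : Continuous σ) {a : ℕ} (N : FNN κ a) :
    Continuous (N.eval σ) := by
  induction N with
  | output W b => exact continuous_pi (continuous_mulVec_add W b)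
  | hidden W b next ih =>
    exact ih.comp (continuous_pi fun i => hσ.comp (continuous_mulVec_add W b i))

/-- The network computing `N (α x + γ)`. -/
def affinePrecomp {κ : Type} (α γ : ℝ) : {a : ℕ} → FNN κ a → FNN κ a
  | _, .output W b => .output (α • W) (W.mulVec (fun _ => γ) + b)
  | _, .hidden W b next => .hidden (α • W) (W.mulVec (fun _ => γ) + b) next

theorem mulVec_affine {κ : Type} {a : ℕ} (W : Matrix κ (Fin a) ℝ) (b : κ → ℝ) (α γ : ℝ)
    (x : Fin a → ℝ) (i : κ) :
    (α • W).mulVec x i + (W.mulVec (fun _ => γ) + b) i = W.mulVec (fun j => α * x j + γ) i + b i := by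
  simp only [Matrix.mulVec, dotProduct, Pi.add_apply, Matrix.smul_apply, smul_eq_mul,
    ← add_assoc, ← Finset.sum_add_distrib]
  congr 1
  exact Finset.sum_congr rfl fun j _ => by ring

theorem eval_affinePrecomp {κ : Type} (σ : ℝ → ℝ) (α γ : ℝ) {a : ℕ} (N : FNN κ a)
    (x : Fin a → ℝ) : (N.affinePrecomp α γ).eval σ x = N.eval σ (fun i => α * x i + γ) := by
  cases N with
  | output W b => funext i; simp only [affinePrecomp, eval, mulVec_affine]
  | hidden W b next => simp only [affinePrecomp, eval, mulVec_affine]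

theorem size_affinePrecomp {κ : Type} [Fintype κ] (α γ : ℝ) {a : ℕ} (N : FNN κ a) :
    (N.affinePrecomp α γ).size = N.size := by
  cases N <;> rfl

/-- Extension of a matrix by zero columns. -/
def padColumns {κ : Type} {a : ℕ} (b : ℕ) (W : Matrix κ (Fin a) ℝ) : Matrix κ (Fin b) ℝ :=
  fun i j => if h : (j : ℕ) < a then W i ⟨j, h⟩ else 0

theorem mulVec_padColumns {κ : Type} {a b : ℕ} (h : a ≤ b) (W : Matrix κ (Fin a) ℝ)
    (x : Fin b → ℝ) : (padColumns b W).mulVec x = W.mulVec (fun j => x (Fin.castLE h j)) := by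
  funext i
  simp only [Matrix.mulVec, dotProduct]
  symm
  refine Finset.sum_of_injOn (Fin.castLE h) (Fin.castLE_injective h).injOn (by simp) ?_ ?_
  · intro j _ hj
    have : ¬ (j : ℕ) < a := fun hja => hj ⟨⟨j, hja⟩, by simp, by ext; simp⟩
    simp [padColumns, this]
  · intro j _
    simp [padColumns]

theorem nnzMatrix_padColumns {κ : Type} [Fintype κ] {a b : ℕ} (h : a ≤ b)
    (W : Matrix κ (Fin a) ℝ) : nnzMatrix (padColumns b W) ≤ nnzMatrix W := by
  unfold nnzMatrix
  refine (Set.ncard_le_ncard (t := (fun p : κ × Fin a => (p.1, Fin.castLE h p.2)) ''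
    {p | W p.1 p.2 ≠ 0}) ?_).trans (Set.ncard_image_le (Set.toFinite _))
  rintro ⟨i, j⟩ hij
  by_cases hj : (j : ℕ) < a
  · exact ⟨(i, ⟨j, hj⟩), by simpa [padColumns, hj] using hij, by simp⟩
  · simp [padColumns, hj] at hij

/-- The network that ignores all but the first `a` coordinates. -/
def padInput {κ : Type} {a : ℕ} (b : ℕ) : FNN κ a → FNN κ b
  | .output W c => .output (padColumns b W) c
  | .hidden W c next => .hidden (padColumns b W) c next

theorem eval_padInput {κ : Type} (σ : ℝ → ℝ) {a b : ℕ} (h : a ≤ b) (N : FNN κ a)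
    (x : Fin b → ℝ) : (N.padInput b).eval σ x = N.eval σ (fun j => x (Fin.castLE h j)) := by
  cases N <;> simp [padInput, eval, mulVec_padColumns h]

theorem activeWeights_padInput {κ : Type} [Fintype κ] {a b : ℕ} (h : a ≤ b) (N : FNN κ a) :
    (N.padInput b).activeWeights ≤ N.activeWeights := by
  cases N <;> simpa [padInput, activeWeights] using nnzMatrix_padColumns h _

end FNN

/-! ### One neuron approximates the exponential function -/

/-- On every bounded interval, a single neuron with activation `σ` approximates `exp` to every
accuracy. -/
def ApproximatesExp (σ : ℝ → ℝ) : Prop :=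
  ∀ r : ℝ, ∀ δ > 0, ∃ α β γ τ : ℝ, ∀ z, |z| ≤ r → |α * σ (β * z + τ) + γ - Real.exp z| ≤ δ

/-- The shift by `-r` moves the whole interval onto the exponential branch of ELU, so the
representation is exact. -/
theorem approximatesExp_elu : ApproximatesExp elu := by
  intro r δ hδ
  refine ⟨Real.exp r, 1, Real.exp r, -r, fun z hz => ?_⟩
  have hz' : z ≤ r := (le_abs_self z).trans hz
  suffices Real.exp r * elu (1 * z + -r) + Real.exp r - Real.exp z = 0 by
    rw [this, abs_zero]; exact hδ.le
  have : elu (1 * z + -r) = Real.exp (z - r) - 1 := by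
    unfold elu
    split_ifs with h
    · have : z = r := by linarith
      simp [this]
    · congr 2; ring
  rw [this, Real.exp_sub]
  field_simp
  ring

/-- Near `-∞`, `1 + tanh y` behaves like `2 exp (2 y)`. With `y = z / 2 - A`, rescaling by `exp (2
A) / 2` gives `exp z` up to an error of at most `exp (2 z - 2 A)`, which is small for large `A`. -/
theorem approximatesExp_tanh : ApproximatesExp Real.tanh := by
  intro r δ hδ
  obtain ⟨A, hA⟩ : ∃ A : ℝ, Real.exp (2 * r - 2 * A) ≤ δ := by
    refine ⟨r - Real.log δ / 2, ?_⟩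
    rw [show 2 * r - 2 * (r - Real.log δ / 2) = Real.log δ by ring, Real.exp_log hδ]
  refine ⟨Real.exp (2 * A) / 2, 1 / 2, Real.exp (2 * A) / 2, -A, fun z hz => ?_⟩
  have hz' : z ≤ r := (le_abs_self z).trans hz
  have key : Real.exp (2 * A) / 2 * Real.tanh (1 / 2 * z + -A) + Real.exp (2 * A) / 2
      = Real.exp z / (1 + Real.exp (z - 2 * A)) := by
    rw [Real.tanh_eq, show -(1 / 2 * z + -A) = A - z / 2 by ring,
      show 1 / 2 * z + -A = z / 2 - A by ring, show z - 2 * A = (z / 2 - A) + (z / 2 - A) by ring,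
      Real.exp_add, Real.exp_sub, Real.exp_sub, show 2 * A = A + A by ring, Real.exp_add,
      show Real.exp z = Real.exp (z / 2) * Real.exp (z / 2) by rw [← Real.exp_add]; ring_nf]
    field_simp
    ring
  rw [key]
  have h1 : 0 < Real.exp (z - 2 * A) := Real.exp_pos _
  have h2 : Real.exp z / (1 + Real.exp (z - 2 * A)) - Real.exp z
      = -(Real.exp z * Real.exp (z - 2 * A) / (1 + Real.exp (z - 2 * A))) := by
    field_simp; ring
  rw [h2, abs_neg, abs_of_nonneg (by positivity)]
  refine (div_le_self (by positivity) (by linarith)).trans ?_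
  rw [← Real.exp_add]
  exact (Real.exp_le_exp.2 (by linarith)).trans hA

/-- Every network with activation `exp` is approximated, uniformly on bounded sets, by networks of
the same size with activation `σ`. -/
theorem FNN.exists_eval_sub_eval_exp_le {σ : ℝ → ℝ} (hσ : Continuous σ) (hexp : ApproximatesExp σ)
    {κ : Type} [Fintype κ] {a : ℕ} (N : FNN κ a) : ∀ r : ℝ, ∀ δ > 0, ∃ N' : FNN κ a,
      N'.size = N.size ∧ ∀ x, ‖x‖ ≤ r → ∀ i, |N'.eval σ x i - N.eval Real.exp x i| ≤ δ := by
  induction N with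
  | output W b => exact fun r δ hδ => ⟨.output W b, rfl, fun x _ i => by simp [eval, hδ.le]⟩
  | @hidden a k W b next ih =>
    intro r δ hδ
    have hpre : Continuous fun x : Fin a → ℝ => W.mulVec x + b :=
      (Continuous.matrix_mulVec continuous_const continuous_id).add continuous_const
    obtain ⟨r₁, hr₁⟩ := ((isCompact_closedBall (0 : Fin a → ℝ) r).image hpre).isBounded.exists_norm_le
    have hz : ∀ x : Fin a → ℝ, ‖x‖ ≤ r → ∀ i, |W.mulVec x i + b i| ≤ r₁ := fun x hx i =>
      (norm_le_pi_norm (W.mulVec x + b) i).trans (hr₁ _ ⟨x, by simpa using hx, rfl⟩)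
    -- The later layers are replaced first, since their modulus of continuity dictates the accuracy
    -- of this layer. The extra radius 1 leaves room for the perturbed outputs.
    obtain ⟨next', hsize, hnext⟩ := ih (Real.exp r₁ + 1) (δ / 2) (half_pos hδ)
    have huc := (isCompact_closedBall (0 : Fin k → ℝ) (Real.exp r₁ + 1)).uniformContinuousOn_of_continuous
      (continuous_eval hσ next').continuousOn
    obtain ⟨η, hη, hclose⟩ := Metric.uniformContinuousOn_iff_le.1 huc (δ / 2) (half_pos hδ)
    obtain ⟨α, β, γ, τ, hσexp⟩ := hexp r₁ (min η 1) (lt_min hη one_pos)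
    -- Both affine maps around the neuron merge into existing weights, so the size does not change.
    refine ⟨.hidden (β • W) (fun j => β * b j + τ) (next'.affinePrecomp α γ), ?_, fun x hx i => ?_⟩
    · simp [size, size_affinePrecomp, hsize]
    · simp only [eval, eval_affinePrecomp]
      set y : Fin k → ℝ := fun j => Real.exp (W.mulVec x j + b j) with hy
      set y' : Fin k → ℝ := fun j =>
        α * σ ((β • W).mulVec x j + (β * b j + τ)) + γ with hy'
      have hd : ∀ j, |y' j - y j| ≤ min η 1 := fun j => by
        have := hσexp _ (hz x hx j)
        rw [hy', hy]
        convert this using 6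
        simp only [Matrix.smul_mulVec, Pi.smul_apply, smul_eq_mul]
        ring
      have hyn : ‖y‖ ≤ Real.exp r₁ := (pi_norm_le_iff_of_nonneg (Real.exp_pos _).le).2 fun j => by
        rw [Real.norm_eq_abs, Real.abs_exp]
        exact Real.exp_le_exp.2 ((le_abs_self _).trans (hz x hx j))
      have hdn : ‖y' - y‖ ≤ min η 1 :=
        (pi_norm_le_iff_of_nonneg (lt_min hη one_pos).le).2 hd
      have hyn' : ‖y'‖ ≤ Real.exp r₁ + 1 := by
        have := norm_add_le (y' - y) y
        rw [sub_add_cancel] at this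
        linarith [hdn.trans (min_le_right _ _)]
      have e1 : |next'.eval σ y' i - next'.eval σ y i| ≤ δ / 2 := by
        have := hclose y' (by simpa using hyn') y (by simp; linarith)
          (by rw [dist_eq_norm]; exact hdn.trans (min_le_left _ _))
        exact (dist_le_pi_dist _ _ i).trans this
      have e2 := hnext y (by linarith) i
      calc |next'.eval σ y' i - next.eval Real.exp y i|
          ≤ |next'.eval σ y' i - next'.eval σ y i| + |next'.eval σ y i - next.eval Real.exp y i| :=
            abs_sub_le _ _ _
        _ ≤ δ := by linarith

/-! ### Approximation of Lipschitz functions -/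

/-- A linear combination of functions `exp (∑ m, A l m * exp (θ * x m))` is a network with two
hidden layers. -/
theorem FNN.exists_eval_exp_eq {κ ι : Type} [Fintype κ] [Fintype ι] {p : ℕ} (θ : ℝ)
    (A : ι → Fin p → ℝ) (w : κ → ι → ℝ) : ∃ N : FNN κ p,
      N.size = p * p + p + (Fintype.card ι * p + Fintype.card ι +
        (Fintype.card κ * Fintype.card ι + Fintype.card κ)) ∧
      ∀ x i, N.eval Real.exp x i =
        ∑ l, w i l * Real.exp (∑ m, A l m * Real.exp (θ * x m)) := by
  let e := Fintype.equivFin ι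
  refine ⟨.hidden (θ • 1) 0 (.hidden (fun l m => A (e.symm l) m) 0
    (.output (fun i l => w i (e.symm l)) 0)), rfl, fun x i => ?_⟩
  simp only [eval, Matrix.smul_mulVec, Matrix.one_mulVec, Pi.zero_apply, add_zero, Pi.smul_apply,
    smul_eq_mul]
  simp only [Matrix.mulVec, dotProduct]
  exact e.symm.sum_comp fun l => w i l * Real.exp (∑ m, A l m * Real.exp (θ * x m))

/-- The partition of unity on `[-M, M]` formed by the increments of the sigmoids
`exp (-exp (θ (x - c_j)))`; it is concentrated near the diagonal for large `θ`. -/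
theorem exists_sigmoid_partition {M : ℝ} (hM : 0 < M) {n : ℕ} (hn : 1 ≤ n) :
    ∃ (θ : ℝ) (b a : ℕ → ℝ), ∀ x, |x| ≤ M →
      (∀ j, 0 ≤ b (j + 1) * Real.exp (a (j + 1) * Real.exp (θ * x))
        - b j * Real.exp (a j * Real.exp (θ * x))) ∧
      (∑ j ∈ Finset.range n, (b (j + 1) * Real.exp (a (j + 1) * Real.exp (θ * x))
        - b j * Real.exp (a j * Real.exp (θ * x)))) = 1 ∧
      (∑ j ∈ Finset.range n, (b (j + 1) * Real.exp (a (j + 1) * Real.exp (θ * x))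
        - b j * Real.exp (a j * Real.exp (θ * x))) * |(-M + j * (2 * M / n)) - x|)
          ≤ 3 * (2 * M / n) := by
  have hn0 : (0 : ℝ) < n := by exact_mod_cast hn
  set w : ℝ := 2 * M / n with hw
  have hw0 : 0 < w := by positivity
  have hnw : n * w = 2 * M := by rw [hw]; field_simp
  -- Each of at most `n` distant cells will have weight at most `exp (-(θ * w))` and distance at
  -- most `2 * M`; together they may contribute one cell width.
  obtain ⟨θ, hθ0, hθ⟩ : ∃ θ : ℝ, 0 < θ ∧ Real.exp (-(θ * w)) * (n * (2 * M)) ≤ w := by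
    have h1 : Tendsto (fun θ : ℝ => Real.exp (-(θ * w)) * (n * (2 * M))) atTop (𝓝 (0 * (n * (2 * M)))) :=
      (Real.tendsto_exp_neg_atTop_nhds_zero.comp (tendsto_id.atTop_mul_const hw0)).mul_const _
    rw [zero_mul] at h1
    obtain ⟨θ, h2, h3⟩ := ((h1.eventually (eventually_le_nhds hw0)).and (eventually_gt_atTop 0)).exists
    exact ⟨θ, h3, h2⟩
  set c : ℕ → ℝ := fun j => -M + j * w with hc
  -- The exceptional coefficients at the two ends force the values `0` at index `0` and `1` at index
  -- `n`, so the increments telescope to exactly `1`.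
  refine ⟨θ, fun j => if j = 0 then 0 else 1,
    fun j => if j < n then -Real.exp (-(θ * c j)) else 0, fun x hx => ?_⟩
  obtain ⟨hx1, hx2⟩ := abs_le.1 hx
  set G : ℕ → ℝ := fun j => (if j = 0 then (0 : ℝ) else 1) *
    Real.exp ((if j < n then -Real.exp (-(θ * c j)) else 0) * Real.exp (θ * x)) with hG
  change (∀ j, 0 ≤ G (j + 1) - G j) ∧ ∑ j ∈ Finset.range n, (G (j + 1) - G j) = 1 ∧
    ∑ j ∈ Finset.range n, (G (j + 1) - G j) * |c j - x| ≤ 3 * w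
  have hG0 : G 0 = 0 := by simp [hG]
  have hGn : ∀ j, n ≤ j → G j = 1 := fun j hj => by
    have : j ≠ 0 := by omega
    simp [hG, this, not_lt.2 hj]
  have hGj : ∀ j, j ≠ 0 → j < n → G j = Real.exp (-Real.exp (θ * (x - c j))) := fun j h0 hj => by
    simp only [hG, if_neg h0, if_pos hj, one_mul, neg_mul, ← Real.exp_add]
    congr 3; ring
  have hGnn : ∀ j, 0 ≤ G j := fun j => by
    simp only [hG]; split_ifs <;> positivity
  have hG1 : ∀ j, G j ≤ 1 := fun j => by
    by_cases h0 : j = 0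
    · simp [h0, hG0]
    by_cases hj : j < n
    · rw [hGj j h0 hj]; exact Real.exp_le_one_iff.2 (neg_nonpos.2 (Real.exp_pos _).le)
    · exact (hGn j (not_lt.1 hj)).le
  have hmono : ∀ j, 0 ≤ G (j + 1) - G j := fun j => by
    by_cases h0 : j = 0
    · simp [h0, hG0, hGnn]
    by_cases hj : j + 1 < n
    · rw [hGj j h0 (by omega), hGj _ (by omega) hj, sub_nonneg, Real.exp_le_exp, neg_le_neg_iff,
        Real.exp_le_exp]
      refine mul_le_mul_of_nonneg_left ?_ hθ0.le
      simp only [hc]; push_cast; linarith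
    · rw [hGn _ (not_lt.1 hj)]; linarith [hG1 j]
  have hsum : ∑ j ∈ Finset.range n, (G (j + 1) - G j) = 1 := by
    rw [Finset.sum_range_sub, hGn n le_rfl, hG0, sub_zero]
  refine ⟨hmono, hsum, ?_⟩
  have hcM : ∀ j < n, |c j - x| ≤ 2 * M := fun j hj => by
    have : (j : ℝ) * w ≤ 2 * M := by
      rw [← hnw]; exact mul_le_mul_of_nonneg_right (by exact_mod_cast hj.le) hw0.le
    have : 0 ≤ (j : ℝ) * w := by positivity
    rw [abs_le]; constructor <;> simp only [hc] <;> linarith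
  -- For `x` far to the left of the cell, `G j` is already close to `1`; far to the right, `G (j +
  -- 1)` is close to `0`. The exceptional end indices cannot occur, since `x` lies between `c 0 =
  -- -M` and `c n = M`.
  have hfar : ∀ j < n, 2 * w < |c j - x| → G (j + 1) - G j ≤ Real.exp (-(θ * w)) := by
    intro j hj hjx
    rcases lt_abs.1 hjx with h | h
    · have h0 : j ≠ 0 := by
        rintro rfl
        simp only [hc, Nat.cast_zero, zero_mul] at h; linarith
      have h1 := Real.add_one_le_exp (-Real.exp (θ * (x - c j)))
      have h2 : Real.exp (θ * (x - c j)) ≤ Real.exp (-(θ * w)) := Real.exp_le_exp.2 (by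
        rw [← mul_neg]; exact mul_le_mul_of_nonneg_left (by linarith) hθ0.le)
      have h3 := hG1 (j + 1)
      rw [hGj j h0 hj]; linarith
    · have hcj : c (j + 1) = c j + w := by simp only [hc]; push_cast; ring
      have h0 : j + 1 < n := by
        by_contra hcon
        have : j + 1 = n := by omega
        rw [this] at hcj
        have : c n = M := by simp only [hc]; linarith
        linarith
      have h2 : θ * w ≤ Real.exp (θ * (x - c (j + 1))) := by
        have := Real.add_one_le_exp (θ * (x - c (j + 1)))
        have : θ * w ≤ θ * (x - c (j + 1)) := mul_le_mul_of_nonneg_left (by linarith) hθ0.le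
        linarith
      have h3 : G (j + 1) ≤ Real.exp (-(θ * w)) := by
        rw [hGj _ (by omega) h0]; exact Real.exp_le_exp.2 (by linarith)
      linarith [hGnn j]
  have hterm : ∀ j ∈ Finset.range n, (G (j + 1) - G j) * |c j - x| ≤
      (G (j + 1) - G j) * (2 * w) + Real.exp (-(θ * w)) * (2 * M) := fun j hj => by
    have hj := Finset.mem_range.1 hj
    by_cases h : |c j - x| ≤ 2 * w
    · have := mul_le_mul_of_nonneg_left h (hmono j)
      have : 0 ≤ Real.exp (-(θ * w)) * (2 * M) := by positivity
      linarith
    · have h1 := mul_le_mul (hfar j hj (not_le.1 h)) (hcM j hj) (abs_nonneg _) (Real.exp_pos _).le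
      have : 0 ≤ (G (j + 1) - G j) * (2 * w) := mul_nonneg (hmono j) (by positivity)
      linarith
  refine (Finset.sum_le_sum hterm).trans ?_
  rw [Finset.sum_add_distrib, ← Finset.sum_mul, hsum, Finset.sum_const, Finset.card_range,
    nsmul_eq_mul]
  linarith

/-- One-dimensional marginals of a product of probability vectors. -/
theorem sum_prod_mul_apply {ι α : Type*} [Fintype ι] [DecidableEq ι] [Fintype α] (H : ι → α → ℝ)
    (hH : ∀ i, ∑ a, H i a = 1) (φ : α → ℝ) (i₀ : ι) :
    ∑ j : ι → α, (∏ i, H i (j i)) * φ (j i₀) = ∑ a, H i₀ a * φ a := by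
  -- With `φ` inserted into the factor `i₀` only, all other factors sum to `1`.
  have h := Fintype.prod_sum (fun i a => H i a * if i = i₀ then φ a else 1)
  rw [Finset.prod_eq_single_of_mem i₀ (Finset.mem_univ _) (fun i _ hi => by simp [hi, hH])] at h
  simp only [if_true, Finset.prod_mul_distrib, Finset.prod_ite_eq', Finset.mem_univ] at h
  rw [h]

/-- Averaging a Lipschitz function against a product of probability vectors. -/
theorem abs_sum_prod_mul_sub_le {p : ℕ} {α : Type*} [Fintype α] (H : Fin p → α → ℝ)
    (hpos : ∀ i a, 0 ≤ H i a) (hH : ∀ i, ∑ a, H i a = 1) (c : α → ℝ) (x : Fin p → ℝ) {ρ Λ : ℝ}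
    (hΛ : 0 ≤ Λ) (hρ : ∀ i, ∑ a, H i a * |c a - x i| ≤ ρ) (g : (Fin p → ℝ) → ℝ)
    (hg : ∀ x y, |g x - g y| ≤ Λ * ‖x - y‖) :
    |∑ j : Fin p → α, (∏ i, H i (j i)) * g (fun i => c (j i)) - g x| ≤ Λ * (p * ρ) := by
  have hone : ∑ j : Fin p → α, ∏ i, H i (j i) = 1 := by
    rw [← Fintype.prod_sum]; simp [hH]
  have hnn : ∀ j : Fin p → α, 0 ≤ ∏ i, H i (j i) := fun j => Finset.prod_nonneg fun i _ => hpos _ _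
  calc |∑ j : Fin p → α, (∏ i, H i (j i)) * g (fun i => c (j i)) - g x|
      = |∑ j : Fin p → α, (∏ i, H i (j i)) * (g (fun i => c (j i)) - g x)| := by
        simp only [mul_sub, Finset.sum_sub_distrib, ← Finset.sum_mul, hone, one_mul]
    _ ≤ ∑ j : Fin p → α, (∏ i, H i (j i)) * (Λ * ∑ i, |c (j i) - x i|) := by
        refine (Finset.abs_sum_le_sum_abs _ _).trans (Finset.sum_le_sum fun j _ => ?_)
        rw [abs_mul, abs_of_nonneg (hnn j)]
        refine mul_le_mul_of_nonneg_left ((hg _ _).trans (mul_le_mul_of_nonneg_left ?_ hΛ)) (hnn j)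
        refine (pi_norm_le_iff_of_nonneg (Finset.sum_nonneg fun _ _ => abs_nonneg _)).2 fun i => ?_
        exact Finset.single_le_sum (f := fun i => |c (j i) - x i|) (fun _ _ => abs_nonneg _)
          (Finset.mem_univ i)
    _ = Λ * ∑ i, ∑ a, H i a * |c a - x i| := by
        simp only [← sum_prod_mul_apply H hH (fun a => |c a - x _|), Finset.mul_sum]
        rw [Finset.sum_comm]
        exact Finset.sum_congr rfl fun i _ => Finset.sum_congr rfl fun j _ => by ring
    _ ≤ Λ * (p * ρ) := by
        refine mul_le_mul_of_nonneg_left ((Finset.sum_le_sum fun i _ => hρ i).trans ?_) hΛ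
        simp

/-- A product of `p` increments expands over subsets of the coordinates (those contributing the
subtracted term) into `2 ^ p` signed products of sigmoids. Each is one neuron of the second layer,
shared by all outputs; there are `n ^ p` grid cells. -/
theorem FNN.exists_eval_exp_sub_le {κ : Type} [Fintype κ] {p n : ℕ} (hn : 1 ≤ n) {M Λ : ℝ}
    (hM : 0 < M) (hΛ : 0 ≤ Λ) (g : (Fin p → ℝ) → κ → ℝ)
    (hg : ∀ i x y, |g x i - g y i| ≤ Λ * ‖x - y‖) : ∃ N : FNN κ p,
      N.size = p * p + p + (n ^ p * 2 ^ p * p + n ^ p * 2 ^ p +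
        (Fintype.card κ * (n ^ p * 2 ^ p) + Fintype.card κ)) ∧
      ∀ x, ‖x‖ ≤ M → ∀ i, |N.eval Real.exp x i - g x i| ≤ Λ * (p * (3 * (2 * M / n))) := by
  obtain ⟨θ, b, a, hab⟩ := exists_sigmoid_partition hM hn
  let c : Fin n → ℝ := fun j => -M + (j : ℕ) * (2 * M / n)
  let s : (Fin p → Fin n) × Finset (Fin p) → Fin p → ℕ := fun l i =>
    if i ∈ l.2 then (l.1 i : ℕ) else l.1 i + 1
  obtain ⟨N, hN, hN'⟩ := FNN.exists_eval_exp_eq (p := p) (κ := κ) θ (fun l i => a (s l i))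
    (fun i l => ((-1) ^ l.2.card * ∏ m, b (s l m)) * g (fun m => c (l.1 m)) i)
  refine ⟨N, by simpa using hN, fun x hx i => ?_⟩
  have hxi : ∀ i, |x i| ≤ M := fun i => (norm_le_pi_norm x i).trans hx
  let G : ℕ → ℝ → ℝ := fun j y => b j * Real.exp (a j * Real.exp (θ * y))
  have key := abs_sum_prod_mul_sub_le (fun i (j : Fin n) => G (j + 1) (x i) - G j (x i))
    (fun i j => (hab _ (hxi i)).1 j)
    (fun i => by
      rw [← (hab _ (hxi i)).2.1, ← Fin.sum_univ_eq_sum_range (fun j => G (j + 1) (x i) - G j (x i))])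
    c x hΛ
    (fun i => by
      refine le_of_eq_of_le ?_ (hab _ (hxi i)).2.2
      rw [← Fin.sum_univ_eq_sum_range (fun j => (G (j + 1) (x i) - G j (x i)) *
        |(-M + j * (2 * M / n)) - x i|)])
    (fun y => g y i) (hg i)
  convert key using 3
  rw [hN', Fintype.sum_prod_type]
  refine Finset.sum_congr rfl fun j _ => ?_
  rw [Finset.prod_sub, Finset.powerset_univ, Finset.sum_mul]
  refine Finset.sum_congr rfl fun t _ => ?_
  have : (∏ m ∈ Finset.univ \ t, G (j m + 1) (x m)) * ∏ m ∈ t, G (j m) (x m)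
      = ∏ m, G (s (j, t) m) (x m) := by
    rw [← Finset.prod_sdiff (Finset.subset_univ t)]
    congr 1
    · exact Finset.prod_congr rfl fun m hm => by simp [s, (Finset.mem_sdiff.1 hm).2]
    · exact Finset.prod_congr rfl fun m hm => by simp [s, hm]
  rw [mul_assoc ((-1 : ℝ) ^ t.card) (∏ m ∈ Finset.univ \ t, _), this, Finset.prod_mul_distrib,
    ← Real.exp_sum]
  ring

/-- Lipschitz functions on a cube of dimension `p` are approximated with accuracy `ε` by networks
with `O(ε⁻ᵖ)` weights per output. -/
theorem FNN.exists_approx {σ : ℝ → ℝ} (hσ : Continuous σ) (hexp : ApproximatesExp σ) (p : ℕ)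
    {M Λ : ℝ} (hM : 0 < M) (hΛ : 0 ≤ Λ) : ∃ A : ℝ, 0 ≤ A ∧ ∀ (κ : Type) [Fintype κ]
      (g : (Fin p → ℝ) → κ → ℝ), (∀ i x y, |g x i - g y i| ≤ Λ * ‖x - y‖) → ∀ ε > 0,
        ∃ N : FNN κ p, (N.size : ℝ) ≤ A * (Fintype.card κ * max 1 (ε⁻¹ ^ p)) ∧
          ∀ x, ‖x‖ ≤ M → ∀ i, |N.eval σ x i - g x i| ≤ ε := by
  -- The averaging error with `n` cells per axis is `6 * M * Λ * p / n`, so `n ≥ 12 * M * Λ * p / ε`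
  -- leaves `ε / 2` for the change of activation. The `2` covers rounding up and adding one.
  set B : ℝ := 12 * M * Λ * p + 2 with hB
  have hB0 : 0 ≤ 12 * M * Λ * p := by positivity
  refine ⟨2 ^ p * B ^ p * (p ^ 2 + 2 * p + 3), by positivity, fun κ _ g hg ε hε => ?_⟩
  -- Without outputs the bound on the size is `0`, so hidden layers must be avoided.
  rcases isEmpty_or_nonempty κ with hκ | hκ
  · exact ⟨.output 0 0, by simp [size], fun x _ i => (hκ.false i).elim⟩
  have hq : (1 : ℝ) ≤ Fintype.card κ := by exact_mod_cast Fintype.card_pos (α := κ)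
  set n : ℕ := ⌈12 * M * Λ * p * ε⁻¹⌉₊ + 1 with hn
  have hn1 : 12 * M * Λ * p * ε⁻¹ ≤ n := (Nat.le_ceil _).trans (by simp [hn])
  have hn2 : (n : ℝ) ≤ B * max 1 ε⁻¹ := by
    have h1 := (Nat.ceil_lt_add_one (show 0 ≤ 12 * M * Λ * p * ε⁻¹ by positivity)).le
    have h2 := mul_le_mul_of_nonneg_left (le_max_right 1 ε⁻¹) hB0
    have h3 := le_max_left 1 ε⁻¹
    rw [hn, hB]; push_cast; linarith
  have hn3 : 1 ≤ n := by omega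
  obtain ⟨N, hN, hNg⟩ := exists_eval_exp_sub_le hn3 hM hΛ g hg
  obtain ⟨N', hN', hNN⟩ := exists_eval_sub_eval_exp_le hσ hexp N M (ε / 2) (half_pos hε)
  refine ⟨N', ?_, fun x hx i => ?_⟩
  · have hk : ((n : ℝ) ^ p * 2 ^ p) ≤ 2 ^ p * B ^ p * max 1 (ε⁻¹ ^ p) := by
      have : max 1 ε⁻¹ ^ p ≤ max 1 (ε⁻¹ ^ p) := by
        rcases max_choice 1 ε⁻¹ with h | h <;> rw [h] <;> simp
      calc (n : ℝ) ^ p * 2 ^ p ≤ (B * max 1 ε⁻¹) ^ p * 2 ^ p := by gcongr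
        _ = 2 ^ p * B ^ p * max 1 ε⁻¹ ^ p := by rw [mul_pow]; ring
        _ ≤ _ := by gcongr
    have hk1 : (1 : ℝ) ≤ (n : ℝ) ^ p * 2 ^ p := by
      exact_mod_cast Nat.mul_pos (pow_pos hn3 p) (pow_pos two_pos p)
    rw [hN', hN]
    push_cast
    set k : ℝ := (n : ℝ) ^ p * 2 ^ p
    set q : ℝ := (Fintype.card κ : ℝ)
    have hp0 : (0 : ℝ) ≤ p := Nat.cast_nonneg p
    have hqk : 1 ≤ q * k := one_le_mul_of_one_le_of_one_le hq hk1
    have hkq : k ≤ q * k := le_mul_of_one_le_left (by linarith) hq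
    have hqq : q ≤ q * k := le_mul_of_one_le_right (by linarith) hk1
    calc (p : ℝ) * p + p + (k * p + k + (q * k + q))
        ≤ (q * k) * (p * p + p) + (q * k * p + q * k + (q * k + q * k)) := by
          gcongr
          exact le_mul_of_one_le_left (by positivity) hqk
      _ = k * (q * (p ^ 2 + 2 * p + 3)) := by ring
      _ ≤ (2 ^ p * B ^ p * max 1 (ε⁻¹ ^ p)) * (q * (p ^ 2 + 2 * p + 3)) := by gcongr
      _ = _ := by ring
  · have h1 := hNN x hx i
    have h2 := hNg x hx i
    have h3 : Λ * (p * (3 * (2 * M / n))) ≤ ε / 2 := by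
      have hn0 : (0 : ℝ) < n := by exact_mod_cast hn3
      rw [← div_eq_mul_inv, div_le_iff₀ hε] at hn1
      rw [show Λ * (p * (3 * (2 * M / n))) = (12 * M * Λ * p) / 2 / n by ring, div_le_iff₀ hn0]
      linarith
    exact (abs_sub_le _ (N.eval Real.exp x i) _).trans (by linarith)

/-! ### Uniform convergence of quadrature rules -/

/-- The error functional of a quadrature rule on continuous functions. -/
noncomputable def quadratureError {T : ℝ} (hT : 0 ≤ T) (ω : ℕ → ℕ → ℕ → ℝ) (N k : ℕ) :
    C(Icc (0 : ℝ) T, ℝ) →L[ℝ] ℝ :=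
  (T / N) • ∑ j ∈ Finset.range (k + 1),
      ω N k j • ContinuousMap.evalCLM ℝ (projIcc 0 T hT (j * (T / N))) -
    LinearMap.mkContinuous
      { toFun := fun f => ∫ t in (0 : ℝ)..(k * (T / N)), f (projIcc 0 T hT t)
        map_add' := fun f g => intervalIntegral.integral_add
          ((f.continuous.comp continuous_projIcc).intervalIntegrable _ _)
          ((g.continuous.comp continuous_projIcc).intervalIntegrable _ _)
        map_smul' := fun c f => intervalIntegral.integral_smul c _ }
      |k * (T / N) - 0| fun f => by
        rw [mul_comm |_|]
        exact intervalIntegral.norm_integral_le_of_norm_le_const fun t _ => f.norm_coe_le_norm _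

theorem quadratureError_apply {T : ℝ} (hT : 0 ≤ T) (ω : ℕ → ℕ → ℕ → ℝ) (N k : ℕ)
    (f : C(Icc (0 : ℝ) T, ℝ)) : quadratureError hT ω N k f =
      quadrature T ω N k (fun t => f (projIcc 0 T hT t)) -
        ∫ t in (0 : ℝ)..(k * (T / N)), f (projIcc 0 T hT t) := by
  simp [quadratureError, quadrature]

theorem grid_mem_Icc {T : ℝ} (hT : 0 ≤ T) {N j : ℕ} (hj : j ≤ N) :
    (j : ℝ) * (T / N) ∈ Icc 0 T := by
  refine ⟨by positivity, ?_⟩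
  rcases Nat.eq_zero_or_pos N with rfl | hN
  · simpa using hT
  · have : (0 : ℝ) < N := by exact_mod_cast hN
    rw [mul_div_left_comm]
    exact mul_le_of_le_one_right hT ((div_le_one this).2 (by exact_mod_cast hj))

theorem quadratureError_apply_restrict {T : ℝ} (hT : 0 ≤ T) (ω : ℕ → ℕ → ℕ → ℝ) {N k : ℕ}
    (hk : k ≤ N) (f : C(Icc (0 : ℝ) T, ℝ)) (g : ℝ → ℝ) (hfg : ∀ t, f t = g t) :
    quadratureError hT ω N k f = quadrature T ω N k g - ∫ t in (0 : ℝ)..(k * (T / N)), g t := by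
  have hproj : ∀ t ∈ Icc 0 T, f (projIcc 0 T hT t) = g t := fun t ht => by
    rw [hfg, projIcc_of_mem hT ht]
  rw [quadratureError_apply, quadrature, quadrature]
  congr 1
  · congr 1
    refine Finset.sum_congr rfl fun j hj => ?_
    rw [hproj _ (grid_mem_Icc hT ((Nat.lt_succ_iff.1 (Finset.mem_range.1 hj)).trans hk))]
  · refine intervalIntegral.integral_congr fun t ht => hproj t ?_
    rw [uIcc_of_le (grid_mem_Icc hT hk).1] at ht
    exact ⟨ht.1, ht.2.trans (grid_mem_Icc hT hk).2⟩

/-- A convergent quadrature rule has uniformly bounded error functionals. -/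
theorem IsConvergentQuadrature.exists_norm_le {T : ℝ} (hT : 0 ≤ T) {ω : ℕ → ℕ → ℕ → ℝ}
    (hω : IsConvergentQuadrature T ω) :
    ∃ B, ∀ N k, 1 ≤ k → k ≤ N → ‖quadratureError hT ω N k‖ ≤ B := by
  have := banach_steinhaus
    (g := fun i : {i : ℕ × ℕ // 1 ≤ i.2 ∧ i.2 ≤ i.1} => quadratureError hT ω i.1.1 i.1.2) fun f => by
      obtain ⟨N₀, hN₀⟩ := eventually_atTop.1 (hω (fun t => f (projIcc 0 T hT t))
        (f.continuous.comp continuous_projIcc).continuousOn 1 one_pos)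
      -- Convergence bounds the errors by `1` for `N ≥ N₀`; only finitely many pairs remain.
      refine ⟨max 1 (∑ i ∈ Finset.range N₀ ×ˢ Finset.range N₀, ‖quadratureError hT ω i.1 i.2 f‖),
        fun ⟨⟨N, k⟩, hk1, hkN⟩ => ?_⟩
      rcases le_or_gt N₀ N with h | h
      · refine le_max_of_le_left ?_
        simpa [quadratureError_apply] using hN₀ N h k hk1 hkN
      · refine le_max_of_le_right ?_
        exact Finset.single_le_sum (f := fun i : ℕ × ℕ => ‖quadratureError hT ω i.1 i.2 f‖)
          (fun _ _ => norm_nonneg _) (a := (N, k)) (by simp; dsimp at *; omega)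
  obtain ⟨B, hB⟩ := this
  exact ⟨B, fun N k h1 h2 => hB ⟨(N, k), h1, h2⟩⟩

/-- Convergence of a quadrature rule is uniform over bounded sets of parameters. -/
theorem IsConvergentQuadrature.eventually_forall_le {T : ℝ} (hT : 0 ≤ T) {ω : ℕ → ℕ → ℕ → ℝ}
    (hω : IsConvergentQuadrature T ω) {d : ℕ} {P : Set (Fin d → ℝ)} (hP : Bornology.IsBounded P)
    {φ : ℝ → (Fin d → ℝ) → ℝ} (hφ : Continuous fun q : (Fin d → ℝ) × ℝ => φ q.2 q.1)
    {η : ℝ} (hη : 0 < η) : ∀ᶠ N : ℕ in atTop, ∀ μ ∈ P, ∀ k : ℕ, 1 ≤ k → k ≤ N →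
      |quadrature T ω N k (fun t => φ t μ) - ∫ t in (0 : ℝ)..(k * (T / N)), φ t μ| ≤ η := by
  obtain ⟨B, hB⟩ := hω.exists_norm_le hT
  -- Currying makes the integrand depend continuously on `μ` in the supremum norm.
  let Q : C(Fin d → ℝ, C(Icc (0 : ℝ) T, ℝ)) :=
    ContinuousMap.curry ⟨fun q => φ q.2 q.1, hφ.comp
      (continuous_fst.prodMk (continuous_subtype_val.comp continuous_snd))⟩
  have hQ : ∀ μ, ∀ t : Icc (0 : ℝ) T, Q μ t = φ t μ := fun μ t => rfl
  suffices ∀ᶠ N : ℕ in atTop, ∀ μ ∈ closure P, ∀ k : ℕ, 1 ≤ k → k ≤ N →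
      |quadratureError hT ω N k (Q μ)| ≤ η by
    filter_upwards [this] with N hN μ hμ k hk1 hkN
    rw [← quadratureError_apply_restrict hT ω hkN (Q μ) _ (hQ μ)]
    exact hN μ (subset_closure hμ) k hk1 hkN
  refine IsCompact.induction_on hP.isCompact_closure
    (p := fun S => ∀ᶠ N : ℕ in atTop, ∀ μ ∈ S, ∀ k : ℕ, 1 ≤ k → k ≤ N →
      |quadratureError hT ω N k (Q μ)| ≤ η) (by simp) ?_ ?_ ?_
  · intro S S' hS h
    filter_upwards [h] with N hN μ hμ using hN μ (hS hμ)
  · intro S S' h h'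
    filter_upwards [h, h'] with N hN hN' μ hμ using hμ.elim (hN μ) (hN' μ)
  · intro μ₀ _
    -- On this neighbourhood the uniform operator bound transfers the convergence at `μ₀` at the
    -- price of `η / 2`.
    refine ⟨{μ | ‖Q μ - Q μ₀‖ * (|B| + 1) < η / 2}, mem_nhdsWithin_of_mem_nhds ?_, ?_⟩
    · have hc : Continuous fun μ => ‖Q μ - Q μ₀‖ * (|B| + 1) :=
        ((Q.continuous.sub continuous_const).norm).mul continuous_const
      exact (isOpen_lt hc continuous_const).mem_nhds (by simp [half_pos hη])
    · filter_upwards [hω (fun t => Q μ₀ (projIcc 0 T hT t))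
        ((Q μ₀).continuous.comp continuous_projIcc).continuousOn (η / 2) (half_pos hη)]
        with N hN μ hμ k hk1 hkN
      have h1 := hN k hk1 hkN
      rw [← quadratureError_apply] at h1
      have hμ' : ‖Q μ - Q μ₀‖ * (|B| + 1) < η / 2 := hμ
      have h2 : |quadratureError hT ω N k (Q μ - Q μ₀)| ≤ η / 2 := by
        refine ((quadratureError hT ω N k).le_opNorm _).trans (le_trans ?_ hμ'.le)
        rw [mul_comm]
        refine mul_le_mul_of_nonneg_left ?_ (norm_nonneg _)
        linarith [hB N k hk1 hkN, le_abs_self B]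
      rw [map_sub] at h2
      have := abs_add_le (quadratureError hT ω N k (Q μ) - quadratureError hT ω N k (Q μ₀))
        (quadratureError hT ω N k (Q μ₀))
      rw [sub_add_cancel] at this
      linarith

/-! ### Latent trajectories -/

section Trajectories

variable {d n : ℕ} {T : ℝ} {K : ℝ≥0} {F : ℝ × (Fin n → ℝ) × (Fin d → ℝ) → Fin n → ℝ}
  {s s' : ℝ → Fin n → ℝ} {μ μ' : Fin d → ℝ}

theorem continuousOn_field (hF : LipschitzWith K F) (hs : ContinuousOn s (Icc 0 T)) :
    ContinuousOn (fun t => F (t, s t, μ)) (Icc 0 T) :=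
  hF.continuous.comp_continuousOn (continuousOn_id.prodMk (hs.prodMk continuousOn_const))

theorem hasDerivAt_of_mem_Ioo
    (hd : ∀ t ∈ Ioc 0 T, HasDerivWithinAt s (F (t, s t, μ)) (Icc 0 T) t) {t : ℝ}
    (ht : t ∈ Ioo 0 T) : HasDerivAt s (F (t, s t, μ)) t :=
  (hd t ⟨ht.1, ht.2.le⟩).hasDerivAt (Icc_mem_nhds ht.1 ht.2)

/-- The differential equation holds at the initial time, too. -/
theorem hasDerivWithinAt_Icc_of_Ioc (hT : 0 < T) (hF : LipschitzWith K F)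
    (hs : ContinuousOn s (Icc 0 T))
    (hd : ∀ t ∈ Ioc 0 T, HasDerivWithinAt s (F (t, s t, μ)) (Icc 0 T) t) :
    ∀ t ∈ Icc 0 T, HasDerivWithinAt s (F (t, s t, μ)) (Icc 0 T) t := by
  intro t ht
  rcases ht.1.eq_or_lt with rfl | h0
  -- At time `0` the one-sided derivative is the limit of the derivatives at positive times.
  · have hmem : Ioo 0 T ∈ 𝓝[>] (0 : ℝ) := Ioo_mem_nhdsGT hT
    refine (hasDerivWithinAt_Ici_of_tendsto_deriv (s := Ioo 0 T)
      (fun x hx => (hasDerivAt_of_mem_Ioo hd hx).differentiableAt.differentiableWithinAt)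
      ((hs 0 ht).mono Ioo_subset_Icc_self) hmem ?_).mono Icc_subset_Ici_self
    have h1 : Tendsto (fun t => F (t, s t, μ)) (𝓝[>] 0) (𝓝 (F (0, s 0, μ))) :=
      (continuousOn_field hF hs 0 ht).mono_left
        (le_trans (nhdsWithin_le_of_mem hmem) (nhdsWithin_mono _ Ioo_subset_Icc_self))
    refine h1.congr' ?_
    filter_upwards [hmem] with x hx using (hasDerivAt_of_mem_Ioo hd hx).deriv.symm
  · exact hd t ⟨h0, ht.2⟩

theorem integral_field_eq (hF : LipschitzWith K F) (hs : ContinuousOn s (Icc 0 T))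
    (hd : ∀ t ∈ Ioc 0 T, HasDerivWithinAt s (F (t, s t, μ)) (Icc 0 T) t) {t : ℝ}
    (ht : t ∈ Icc 0 T) (i : Fin n) : ∫ τ in (0 : ℝ)..t, F (τ, s τ, μ) i = s t i - s 0 i := by
  have hsub : Icc 0 t ⊆ Icc 0 T := Icc_subset_Icc_right ht.2
  refine intervalIntegral.integral_eq_sub_of_hasDerivAt_of_le (f := fun τ => s τ i) ht.1
    ((continuous_apply i).comp_continuousOn (hs.mono hsub))
    (fun x hx => hasDerivAt_pi.1 (hasDerivAt_of_mem_Ioo hd ⟨hx.1, hx.2.trans_le ht.2⟩) i) ?_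
  refine ContinuousOn.intervalIntegrable ?_
  rw [uIcc_of_le ht.1]
  exact (continuous_apply i).comp_continuousOn ((continuousOn_field hF hs).mono hsub)

/-- Along a bounded trajectory, a Lipschitz vector field is bounded. -/
theorem norm_field_le (hT : 0 < T) (hF : LipschitzWith K F) (hs : ContinuousOn s (Icc 0 T))
    (hd : ∀ t ∈ Ioc 0 T, HasDerivWithinAt s (F (t, s t, μ)) (Icc 0 T) t) {R : ℝ}
    (hR : ∀ t ∈ Icc 0 T, ‖s t‖ ≤ R) {t : ℝ} (ht : t ∈ Icc 0 T) :
    ‖F (t, s t, μ)‖ ≤ 2 * R / T + K * (T + 2 * R) := by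
  have h0 : (0 : ℝ) ∈ Icc 0 T := ⟨le_rfl, hT.le⟩
  have hT' : T ∈ Icc 0 T := ⟨hT.le, le_rfl⟩
  have hR0 : 0 ≤ R := (norm_nonneg _).trans (hR 0 h0)
  refine (pi_norm_le_iff_of_nonneg (by positivity)).2 fun i => ?_
  -- The mean value theorem bounds each velocity component at some time by `2 * R / T`; the
  -- Lipschitz condition carries this to all times, since times differ by at most `T` and states by
  -- at most `2 * R`.
  obtain ⟨c, hc, hce⟩ := exists_hasDerivAt_eq_slope (fun τ => s τ i) (fun τ => F (τ, s τ, μ) i) hT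
    ((continuous_apply i).comp_continuousOn hs)
    (fun x hx => hasDerivAt_pi.1 (hasDerivAt_of_mem_Ioo hd hx) i)
  have hc' : c ∈ Icc 0 T := Ioo_subset_Icc_self hc
  have h1 : ‖F (c, s c, μ) i‖ ≤ 2 * R / T := by
    rw [hce, sub_zero, norm_div, Real.norm_of_nonneg hT.le]
    refine div_le_div_of_nonneg_right ?_ hT.le
    calc ‖s T i - s 0 i‖ ≤ ‖s T - s 0‖ := norm_le_pi_norm (s T - s 0) i
      _ ≤ ‖s T‖ + ‖s 0‖ := norm_sub_le _ _
      _ ≤ 2 * R := by linarith [hR T hT', hR 0 h0]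
  have h2 : ‖F (t, s t, μ) i - F (c, s c, μ) i‖ ≤ K * (T + 2 * R) := by
    refine (norm_le_pi_norm (F (t, s t, μ) - F (c, s c, μ)) i).trans ?_
    rw [← dist_eq_norm]
    refine (hF.dist_le_mul _ _).trans (mul_le_mul_of_nonneg_left ?_ K.2)
    rw [Prod.dist_eq, Prod.dist_eq, dist_self]
    refine max_le ?_ (max_le ?_ (by linarith))
    · rw [Real.dist_eq, abs_le]; constructor <;> linarith [ht.1, ht.2, hc'.1, hc'.2]
    · rw [dist_eq_norm]; linarith [norm_sub_le (s t) (s c), hR t ht, hR c hc']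
  calc ‖F (t, s t, μ) i‖ = ‖F (c, s c, μ) i + (F (t, s t, μ) i - F (c, s c, μ) i)‖ := by
        rw [add_sub_cancel]
    _ ≤ _ := (norm_add_le _ _).trans (add_le_add h1 h2)

/-- Trajectories with the same initial state depend on the parameter in a Lipschitz way. -/
theorem norm_trajectory_sub_le (hT : 0 < T) (hF : LipschitzWith K F)
    (hs : ContinuousOn s (Icc 0 T))
    (hd : ∀ t ∈ Ioc 0 T, HasDerivWithinAt s (F (t, s t, μ)) (Icc 0 T) t)
    (hs' : ContinuousOn s' (Icc 0 T))
    (hd' : ∀ t ∈ Ioc 0 T, HasDerivWithinAt s' (F (t, s' t, μ')) (Icc 0 T) t)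
    (h0 : s 0 = s' 0) {t : ℝ} (ht : t ∈ Icc 0 T) :
    ‖s t - s' t‖ ≤ Real.exp ((K + 1) * T) * ‖μ - μ'‖ := by
  have hK : (0 : ℝ) ≤ K := K.2
  have hIci : ∀ x ∈ Ico 0 T, Icc 0 T ∈ 𝓝[≥] x := fun x hx =>
    mem_of_superset (Icc_mem_nhdsGE hx.2) (Icc_subset_Icc_left hx.1)
  -- The rate `K + 1` is never zero, so the closed form of the Grönwall bound applies even for `K =
  -- 0`.
  have h := norm_le_gronwallBound_of_norm_deriv_right_le (f := fun t => s t - s' t)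
    (f' := fun t => F (t, s t, μ) - F (t, s' t, μ')) (δ := 0) (K := K + 1) (ε := K * ‖μ - μ'‖)
    (hs.sub hs')
    (fun x hx => ((hasDerivWithinAt_Icc_of_Ioc hT hF hs hd x ⟨hx.1, hx.2.le⟩).sub
      (hasDerivWithinAt_Icc_of_Ioc hT hF hs' hd' x ⟨hx.1, hx.2.le⟩)).mono_of_mem_nhdsWithin
        (hIci x hx))
    (by simp [h0])
    (fun x _ => by
      rw [← dist_eq_norm]
      refine (hF.dist_le_mul _ _).trans ?_
      rw [Prod.dist_eq, Prod.dist_eq, dist_self, dist_eq_norm, dist_eq_norm]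
      have : max 0 (max ‖s x - s' x‖ ‖μ - μ'‖) ≤ ‖s x - s' x‖ + ‖μ - μ'‖ :=
        max_le (by positivity) (max_le (by simp) (by simp))
      have := mul_le_mul_of_nonneg_left this hK
      linarith [norm_nonneg (s x - s' x)]) t ht
  refine h.trans ?_
  rw [gronwallBound_of_K_ne_0 (by positivity)]
  simp only [sub_zero, zero_mul, zero_add]
  have h1 : (K : ℝ) * ‖μ - μ'‖ / (K + 1) ≤ ‖μ - μ'‖ := by
    rw [div_le_iff₀ (by positivity)]; nlinarith [norm_nonneg (μ - μ')]
  have h2 : Real.exp ((K + 1) * t) - 1 ≤ Real.exp ((K + 1) * T) := by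
    have := Real.exp_le_exp.2 (mul_le_mul_of_nonneg_left ht.2 (by positivity : (0 : ℝ) ≤ K + 1))
    linarith
  calc (K : ℝ) * ‖μ - μ'‖ / (K + 1) * (Real.exp ((K + 1) * t) - 1)
      ≤ (K : ℝ) * ‖μ - μ'‖ / (K + 1) * Real.exp ((K + 1) * T) := by gcongr
    _ ≤ ‖μ - μ'‖ * Real.exp ((K + 1) * T) := by gcongr
    _ = _ := mul_comm _ _

theorem norm_trajectory_sub_time_le (hT : 0 < T) (hF : LipschitzWith K F)
    (hs : ContinuousOn s (Icc 0 T))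
    (hd : ∀ t ∈ Ioc 0 T, HasDerivWithinAt s (F (t, s t, μ)) (Icc 0 T) t) {R : ℝ}
    (hR : ∀ t ∈ Icc 0 T, ‖s t‖ ≤ R) {t t' : ℝ} (ht : t ∈ Icc 0 T) (ht' : t' ∈ Icc 0 T) :
    ‖s t - s t'‖ ≤ (2 * R / T + K * (T + 2 * R)) * |t - t'| :=
  (convex_Icc 0 T).norm_image_sub_le_of_norm_hasDerivWithin_le
    (hasDerivWithinAt_Icc_of_Ioc hT hF hs hd) (fun _ hx => norm_field_le hT hF hs hd hR hx) ht' ht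

end Trajectories

/-- A Lipschitz constant for the velocity of a latent trajectory, as a function of time and the
parameters. -/
noncomputable def velocityLipschitz (T : ℝ) (K : ℝ≥0) (R : ℝ) : ℝ≥0 :=
  K * (1 + (Real.toNNReal (2 * R / T + K * (T + 2 * R)) + Real.toNNReal (Real.exp ((K + 1) * T))))

/-- The velocity of the latent trajectories is a Lipschitz function of time and the parameters. -/
theorem exists_velocity {d n : ℕ} {T : ℝ} (hT : 0 < T) {P : Set (Fin d → ℝ)} {K : ℝ≥0}
    {F : ℝ × (Fin n → ℝ) × (Fin d → ℝ) → Fin n → ℝ} (hF : LipschitzWith K F)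
    {s : ℝ → (Fin d → ℝ) → Fin n → ℝ}
    (hs : ∀ μ ∈ P, ContinuousOn (fun t => s t μ) (Icc 0 T))
    (hd : ∀ μ ∈ P, ∀ t ∈ Ioc 0 T,
      HasDerivWithinAt (fun τ => s τ μ) (F (t, s t μ, μ)) (Icc 0 T) t)
    {s₀ : Fin n → ℝ} (h0 : ∀ μ ∈ P, s 0 μ = s₀) {R : ℝ}
    (hR : ∀ μ ∈ P, ∀ t ∈ Icc 0 T, ‖s t μ‖ ≤ R) :
    ∃ g : (Fin (d + 1) → ℝ) → Fin n → ℝ, LipschitzWith (velocityLipschitz T K R) g ∧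
      ∀ μ ∈ P, ∀ t ∈ Icc 0 T, ∀ i,
        ∫ τ in (0 : ℝ)..t, g (Matrix.vecCons τ μ) i = s t μ i - s₀ i := by
  set S : Set (Fin (d + 1) → ℝ) := {x | x 0 ∈ Icc 0 T ∧ Fin.tail x ∈ P}
  have hg₀ : LipschitzOnWith (velocityLipschitz T K R)
      (fun x : Fin (d + 1) → ℝ => F (x 0, s (x 0) (Fin.tail x), Fin.tail x)) S := by
    refine LipschitzOnWith.of_dist_le_mul fun x hx y hy => ?_
    refine (hF.dist_le_mul _ _).trans ?_
    rw [velocityLipschitz, NNReal.coe_mul, mul_assoc]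
    refine mul_le_mul_of_nonneg_left ?_ K.2
    push_cast
    have hx0 : |x 0 - y 0| ≤ dist x y := by
      rw [← Real.dist_eq]; exact dist_le_pi_dist x y 0
    have hxt : dist (Fin.tail x) (Fin.tail y) ≤ dist x y :=
      (dist_pi_le_iff dist_nonneg).2 fun i => dist_le_pi_dist x y i.succ
    have h1 := norm_trajectory_sub_time_le hT hF (hs _ hx.2) (hd _ hx.2) (hR _ hx.2) hx.1 hy.1
    have h2 := norm_trajectory_sub_le hT hF (hs _ hx.2) (hd _ hx.2) (hs _ hy.2) (hd _ hy.2)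
      ((h0 _ hx.2).trans (h0 _ hy.2).symm) hy.1
    rw [← dist_eq_norm] at h1 h2
    rw [← dist_eq_norm] at h2
    -- Time changes first at fixed parameter, then the parameter at fixed time.
    have h3 := dist_triangle (s (x 0) (Fin.tail x)) (s (y 0) (Fin.tail x)) (s (y 0) (Fin.tail y))
    set B := 2 * R / T + K * (T + 2 * R)
    set E := Real.exp ((K + 1) * T)
    have h4 : B * |x 0 - y 0| ≤ (Real.toNNReal B : ℝ) * dist x y :=
      mul_le_mul (Real.le_coe_toNNReal B) hx0 (abs_nonneg _) (NNReal.coe_nonneg _)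
    have h5 : E * dist (Fin.tail x) (Fin.tail y) ≤ (Real.toNNReal E : ℝ) * dist x y :=
      mul_le_mul (Real.le_coe_toNNReal E) hxt dist_nonneg (NNReal.coe_nonneg _)
    have h6 : 0 ≤ (Real.toNNReal B : ℝ) * dist x y := by positivity
    have h7 : 0 ≤ (Real.toNNReal E : ℝ) * dist x y := by positivity
    have h8 : 0 ≤ dist x y := dist_nonneg
    rw [add_mul, add_mul, one_mul, Prod.dist_eq, Prod.dist_eq, Real.dist_eq]
    refine max_le ?_ (max_le ?_ ?_) <;> dsimp only <;> linarith
  obtain ⟨g, hg, hgS⟩ := hg₀.extend_pi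
  refine ⟨g, hg, fun μ hμ t ht i => ?_⟩
  rw [← h0 μ hμ, ← integral_field_eq hF (hs μ hμ) (hd μ hμ) ht i]
  refine intervalIntegral.integral_congr fun τ hτ => ?_
  rw [uIcc_of_le ht.1] at hτ
  have : Matrix.vecCons τ μ ∈ S := ⟨⟨hτ.1, hτ.2.trans ht.2⟩, by
    simpa [Matrix.vecCons, Fin.tail_cons] using hμ⟩
  have h := congrFun (hgS this) i
  simp only [Matrix.vecCons, Fin.tail_cons, Fin.cons_zero] at h
  exact h.symm

/-! ### Consequences of the perfect embedding assumption -/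

theorem Seminorm.exists_le_mul_norm {Nh : ℕ} (ν : Seminorm ℝ (Fin Nh → ℝ)) :
    ∃ κ : ℝ, ∀ x, ν x ≤ κ * ‖x‖ := by
  refine ⟨∑ i, ν (Pi.single i 1), fun x => ?_⟩
  calc ν x = ν (∑ i, x i • (Pi.single i 1 : Fin Nh → ℝ)) := by rw [← pi_eq_sum_univ' x]
    _ ≤ ∑ i, ν (x i • (Pi.single i 1 : Fin Nh → ℝ)) :=
        Finset.le_sum_of_subadditive ν (map_zero ν).le (map_add_le_add ν) _ _
    _ ≤ ∑ i, ν (Pi.single i 1) * ‖x‖ := Finset.sum_le_sum fun i _ => by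
        rw [map_smul_eq_mul, mul_comm]
        exact mul_le_mul_of_nonneg_left (norm_le_pi_norm x i) (apply_nonneg _ _)
    _ = _ := (Finset.sum_mul _ _ _).symm

section Embedding

variable {d Nh n : ℕ} {T : ℝ} {P : Set (Fin d → ℝ)} {u : ℝ → (Fin d → ℝ) → (Fin Nh → ℝ)}
  {u₀ : Fin Nh → ℝ} {Φ : (Fin n → ℝ) → (Fin Nh → ℝ)}
  {f : ℝ → (Fin n → ℝ) → (Fin d → ℝ) → (Fin n → ℝ)} {s : ℝ → (Fin d → ℝ) → (Fin n → ℝ)}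
  {Ψ : (Fin Nh → ℝ) → (Fin n → ℝ)}

/-- In the maximum norm, extending each component separately keeps the Lipschitz constant. The
extension also supplies a value at time `0`. -/
theorem IsLatentEmbedding.exists_field_extension (h : IsLatentEmbedding T P u Φ f s Ψ) {K : ℝ≥0}
    (hf : LipschitzField T P K f) :
    ∃ F : ℝ × (Fin n → ℝ) × (Fin d → ℝ) → Fin n → ℝ, LipschitzWith K F ∧
      ∀ μ ∈ P, ∀ t ∈ Ioc 0 T,
        HasDerivWithinAt (fun τ => s τ μ) (F (t, s t μ, μ)) (Icc 0 T) t := by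
  obtain ⟨F, hF, hfF⟩ := LipschitzOnWith.extend_pi hf
  refine ⟨F, hF, fun μ hμ t ht => ?_⟩
  rw [← hfF (show (t, s t μ, μ) ∈ Ioc 0 T ×ˢ (univ ×ˢ P) from ⟨ht, mem_univ _, hμ⟩)]
  exact h.state_deriv μ hμ t ht

/-- By Grönwall, all trajectories stay within a bounded distance of a single one, which is compact;
a `C¹` decoder is Lipschitz on compact balls. -/
theorem IsLatentEmbedding.exists_embeddingBounds (h : IsLatentEmbedding T P u Φ f s Ψ)
    (hT : 0 < T) (hP : Bornology.IsBounded P) (hu₀ : ∀ μ ∈ P, u 0 μ = u₀) :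
    ∃ (K : ℝ≥0) (R : ℝ) (L : ℝ≥0), EmbeddingBounds T P u n K R L := by
  obtain ⟨K, hK⟩ := h.field_lipschitz
  obtain ⟨F, hF, hd⟩ := h.exists_field_extension hK
  obtain ⟨R, hR⟩ : ∃ R : ℝ, ∀ μ ∈ P, ∀ t ∈ Icc 0 T, ‖s t μ‖ ≤ R := by
    rcases P.eq_empty_or_nonempty with rfl | ⟨μ₀, hμ₀⟩
    · exact ⟨0, fun μ hμ => hμ.elim⟩
    obtain ⟨r, hr⟩ := (isCompact_Icc.image_of_continuousOn
      (h.state_continuous μ₀ hμ₀)).isBounded.exists_norm_le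
    obtain ⟨D, hD⟩ := Metric.isBounded_iff.1 hP
    refine ⟨Real.exp ((K + 1) * T) * D + r, fun μ hμ t ht => ?_⟩
    have h1 := norm_trajectory_sub_le hT hF (h.state_continuous μ hμ) (hd μ hμ)
      (h.state_continuous μ₀ hμ₀) (hd μ₀ hμ₀)
      (by rw [h.encode μ hμ, h.encode μ₀ hμ₀, hu₀ μ hμ, hu₀ μ₀ hμ₀]) ht
    have h2 := mul_le_mul_of_nonneg_left (hD hμ hμ₀) (Real.exp_pos ((K + 1) * T)).le
    have h3 := hr _ ⟨t, ht, rfl⟩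
    rw [dist_eq_norm] at h2
    have h4 := norm_add_le (s t μ - s t μ₀) (s t μ₀)
    rw [sub_add_cancel] at h4
    dsimp only at h1 h3
    linarith
  obtain ⟨L, hL⟩ := (h.decoder_contDiff.locallyLipschitz.locallyLipschitzOn
    (s := Metric.closedBall 0 (R + 1))).exists_lipschitzOnWith_of_compact
      (isCompact_closedBall _ _)
  exact ⟨K, R, L, Φ, f, s, Ψ, h, hK, hR, hL⟩

/-- With globally Lipschitz decoder and velocity, which depends on time and the parameters only. -/
theorem EmbeddingBounds.exists_decoder_velocity {K : ℝ≥0} {R : ℝ} {L : ℝ≥0}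
    (h : EmbeddingBounds T P u n K R L) (hT : 0 < T) (hu₀ : ∀ μ ∈ P, u 0 μ = u₀) :
    ∃ (D : (Fin n → ℝ) → (Fin Nh → ℝ)) (g : (Fin (d + 1) → ℝ) → Fin n → ℝ)
      (s : ℝ → (Fin d → ℝ) → (Fin n → ℝ)),
      LipschitzWith L D ∧ LipschitzWith (velocityLipschitz T K R) g ∧
      ∀ μ ∈ P, ∀ t ∈ Ioc 0 T, u t μ = D (s t μ) ∧ ‖s t μ‖ ≤ 2 * R ∧
        ∀ i, ∫ τ in (0 : ℝ)..t, g (Matrix.vecCons τ μ) i = s t μ i := by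
  obtain ⟨Φ, f, s, Ψ, hE, hf, hR, hΦ⟩ := h
  obtain ⟨F, hF, hd⟩ := hE.exists_field_extension hf
  have h0 : ∀ μ ∈ P, s 0 μ = Ψ u₀ := fun μ hμ => by rw [hE.encode μ hμ, hu₀ μ hμ]
  obtain ⟨g, hg, hgs⟩ := exists_velocity hT hF hE.state_continuous hd h0 hR
  obtain ⟨D, hD, hDΦ⟩ := hΦ.extend_pi
  -- The common initial state is moved into the decoder, so shifted trajectories start at `0` and
  -- equal the integral of their velocity.
  refine ⟨fun x => D (x + Ψ u₀), g, fun t μ => s t μ - Ψ u₀, ?_, hg, fun μ hμ t ht => ⟨?_, ?_, ?_⟩⟩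
  · refine LipschitzWith.of_dist_le_mul fun x y => ?_
    simpa using hD.dist_le_mul (x + Ψ u₀) (y + Ψ u₀)
  · have hts := hR μ hμ t (Ioc_subset_Icc_self ht)
    dsimp only
    rw [sub_add_cancel, hE.decode μ hμ t ht]
    exact hDΦ (by simpa using hts.trans (by linarith))
  · have h1 := hR μ hμ t (Ioc_subset_Icc_self ht)
    have h2 := hR μ hμ 0 ⟨le_rfl, hT.le⟩
    rw [h0 μ hμ] at h2
    dsimp only
    linarith [norm_sub_le (s t μ) (Ψ u₀)]
  · exact hgs μ hμ t (Ioc_subset_Icc_self ht)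

end Embedding

/-! ### Approximation by networks -/

/-- A fully connected network as a graph decoder with `m` trivial convolution layers. -/
def FNN.toGraphDecoder {n : ℕ} {V : Type} {c : ℕ} (N : FNN (V × Fin c) n) (m : ℕ) :
    GraphDecoder n V c :=
  ⟨N, List.replicate m ⟨0, 0⟩⟩

/-- With zero weights and `σ 0 = 0`, the skip connection makes each convolution layer the identity.
-/
theorem FNN.eval_toGraphDecoder {n : ℕ} {V : Type} [Fintype V] {c : ℕ} (G : SimpleGraph V)
    [DecidableRel G.Adj] {σ : ℝ → ℝ} (hσ : σ 0 = 0) (N : FNN (V × Fin c) n) (m : ℕ)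
    (x : Fin n → ℝ) (v : V) (i : Fin c) :
    (N.toGraphDecoder m).eval G σ x v i = N.eval σ x (v, i) := by
  have h : ∀ y : V → Fin c → ℝ, GraphConv.apply G σ ⟨0, 0⟩ y = y := fun y => by
    funext v i
    simp [GraphConv.apply, hσ]
  have h' : ∀ (m : ℕ) (y : V → Fin c → ℝ),
      (List.replicate m (⟨0, 0⟩ : GraphConv c)).foldl (fun h l => l.apply G σ h) y = y := by
    intro m
    induction m with
    | zero => exact fun y => rfl
    | succ m ih => exact fun y => by rw [List.replicate_succ, List.foldl_cons, h, ih]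
  exact congrFun (congrFun (h' m _) v) i

theorem FNN.activeWeights_toGraphDecoder {n : ℕ} {V : Type} [Fintype V] {c : ℕ}
    (N : FNN (V × Fin c) n) (m : ℕ) : (N.toGraphDecoder m).activeWeights = N.activeWeights := by
  simp [toGraphDecoder, GraphDecoder.activeWeights, GraphConv.activeWeights, nnzMatrix, nnzVec]

/-- Converts a weight count at a rescaled accuracy and dimension `p` into one at accuracy `ε` and
dimension `q`. The factor involves `p` only, which keeps `C` independent of `n`. -/
theorem max_one_pow_le {a b D : ℝ} (hb : 0 ≤ b) (hD : 0 ≤ D) (h : b ≤ D * max 1 a)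
    {p q : ℕ} (hpq : p ≤ q) : max 1 (b ^ p) ≤ (1 + D ^ p) * max 1 (a ^ q) := by
  have h1 : max 1 a ^ p ≤ max 1 (a ^ q) := by
    rcases le_total a 1 with h | h
    · simp [max_eq_left h]
    · rw [max_eq_right h]
      exact (pow_le_pow_right₀ h hpq).trans (le_max_right _ _)
  have h2 : 0 ≤ D ^ p := pow_nonneg hD p
  have h3 := le_max_left 1 (a ^ q)
  refine max_le ?_ ?_
  · nlinarith
  · have h4 := pow_le_pow_left₀ hb h p
    rw [mul_pow] at h4
    nlinarith [mul_le_mul_of_nonneg_left h1 h2]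

theorem continuous_tanh : Continuous Real.tanh := by
  rw [show Real.tanh = fun x => Real.sinh x / Real.cosh x from funext Real.tanh_eq_sinh_div_cosh]
  exact Real.continuous_sinh.div Real.continuous_cosh fun x => (Real.cosh_pos x).ne'

/-- If the dynamics network approximates the velocity, the latent states approximate its
primitive. -/
theorem IsConvergentQuadrature.eventually_latentState_sub_le {d n : ℕ} {T : ℝ} (hT : 0 < T)
    {ω : ℕ → ℕ → ℕ → ℝ} (hω : IsConvergentQuadrature T ω) {P : Set (Fin d → ℝ)}
    (hP : Bornology.IsBounded P) {dyn : FNN (Fin n) (d + 1)} {g : (Fin (d + 1) → ℝ) → Fin n → ℝ}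
    (hg : Continuous g) {e : ℝ} (he : 0 < e)
    (hdyn : ∀ μ ∈ P, ∀ t ∈ Icc 0 T, ∀ i,
      |dyn.eval Real.tanh (Matrix.vecCons t μ) i - g (Matrix.vecCons t μ) i| ≤ e / (2 * T)) :
    ∀ᶠ N : ℕ in atTop, ∀ μ ∈ P, ∀ k : ℕ, 1 ≤ k → k ≤ N → ∀ i,
      |latentState T ω dyn N k μ i -
        ∫ t in (0 : ℝ)..(k * (T / N)), g (Matrix.vecCons t μ) i| ≤ e := by
  have hcons : Continuous fun q : (Fin d → ℝ) × ℝ => (Matrix.vecCons q.2 q.1 : Fin (d + 1) → ℝ) :=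
    Continuous.finCons (A := fun _ => ℝ) continuous_snd continuous_fst
  have hdynC := FNN.continuous_eval continuous_tanh dyn
  have hall : ∀ᶠ N : ℕ in atTop, ∀ i, ∀ μ ∈ P, ∀ k : ℕ, 1 ≤ k → k ≤ N →
      |latentState T ω dyn N k μ i -
        ∫ t in (0 : ℝ)..(k * (T / N)), dyn.eval Real.tanh (Matrix.vecCons t μ) i| ≤ e / 2 :=
    eventually_all.2 fun i => hω.eventually_forall_le hT.le hP
      (φ := fun t μ => dyn.eval Real.tanh (Matrix.vecCons t μ) i)
      ((continuous_apply i).comp (hdynC.comp hcons)) (half_pos he)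
  filter_upwards [hall] with N hN μ hμ k hk1 hkN i
  have hcμ : Continuous fun t : ℝ => (Matrix.vecCons t μ : Fin (d + 1) → ℝ) :=
    hcons.comp (continuous_const.prodMk continuous_id)
  have hc₁ : Continuous fun τ => dyn.eval Real.tanh (Matrix.vecCons τ μ) i :=
    (continuous_apply i).comp (hdynC.comp hcμ)
  have hc₂ : Continuous fun τ => g (Matrix.vecCons τ μ) i :=
    (continuous_apply i).comp (hg.comp hcμ)
  have ht := grid_mem_Icc hT.le hkN
  set t : ℝ := k * (T / N)
  have h1 : |(∫ τ in (0 : ℝ)..t, dyn.eval Real.tanh (Matrix.vecCons τ μ) i) -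
      ∫ τ in (0 : ℝ)..t, g (Matrix.vecCons τ μ) i| ≤ e / 2 := by
    rw [← intervalIntegral.integral_sub (hc₁.intervalIntegrable _ _) (hc₂.intervalIntegrable _ _),
      ← Real.norm_eq_abs]
    refine (intervalIntegral.norm_integral_le_of_norm_le_const (C := e / (2 * T))
      fun τ hτ => ?_).trans ?_
    · rw [uIoc_of_le ht.1] at hτ
      exact hdyn μ hμ τ ⟨hτ.1.le, hτ.2.trans ht.2⟩ i
    · rw [sub_zero, abs_of_nonneg ht.1]
      calc e / (2 * T) * t ≤ e / (2 * T) * T := by gcongr; exact ht.2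
        _ = e / 2 := by field_simp
  exact (abs_sub_le _ _ _).trans ((add_le_add (hN i μ hμ k hk1 hkN) h1).trans (by linarith))

/-- The quantitative approximation result for fixed constants. -/
theorem exists_weight_constant (d : ℕ) {T : ℝ} (hT : 0 < T) {P : Set (Fin d → ℝ)}
    (hP : Bornology.IsBounded P) (nstar : ℕ) (K : ℝ≥0) (R : ℝ) (L : ℝ≥0) (κ : ℝ) :
    ∃ C : ℝ, ∀ (Nh : ℕ) (G : SimpleGraph (Fin Nh)) [DecidableRel G.Adj]
        (u₀ : Fin Nh → ℝ) (u : ℝ → (Fin d → ℝ) → (Fin Nh → ℝ))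
        (ν : Seminorm ℝ (Fin Nh → ℝ)),
        (∀ μ ∈ P, u 0 μ = u₀) → EmbeddingBounds T P u nstar K R L → (∀ x, ν x ≤ κ * ‖x‖) →
          ∀ n ≥ nstar, ∀ (m : ℕ), ∀ ε > 0,
            ∃ (dyn : FNN (Fin n) (d + 1)) (dec : GraphDecoder n (Fin Nh) 1),
              (dyn.activeWeights : ℝ) ≤ C * (n * max 1 (ε⁻¹ ^ (d + 1))) ∧
              (dec.activeWeights : ℝ) ≤ C * (Nh * max 1 (ε⁻¹ ^ n)) ∧
              dec.convs.length = m ∧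
              ∀ ω : ℕ → ℕ → ℕ → ℝ, IsConvergentQuadrature T ω →
                ∃ Δtstar > 0, ∀ N : ℕ, 1 ≤ N → T / N ≤ Δtstar →
                  ∀ μ ∈ P, ∀ k : ℕ, 1 ≤ k → k ≤ N →
                    ν (fun v => u (k * (T / N)) μ v -
                      dec.eval G elu (latentState T ω dyn N k μ) v 0) ≤ ε := by
  obtain ⟨ρ, hρ0, hρ⟩ := hP.exists_pos_norm_le
  obtain ⟨A₁, hA₁, hdyn⟩ := FNN.exists_approx continuous_tanh approximatesExp_tanh (d + 1)
    (M := ρ + T) (by positivity) (velocityLipschitz T K R).coe_nonneg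
  obtain ⟨A₂, hA₂, hdec⟩ := FNN.exists_approx continuous_elu approximatesExp_elu nstar
    (M := 2 * |R| + 1) (by positivity) L.coe_nonneg
  -- A positive replacement for `κ`, by which the tolerance can be divided.
  set κ' : ℝ := max κ 1
  have hκ' : 1 ≤ κ' := le_max_right _ _
  have hL : (0 : ℝ) ≤ L := L.coe_nonneg
  set D : ℝ := 2 * κ' * (L + 1) with hD
  have hD1 : 1 ≤ D := by nlinarith
  refine ⟨A₁ * (1 + (2 * T * D) ^ (d + 1)) + A₂ * (1 + (2 * κ') ^ nstar), ?_⟩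
  intro Nh G _ u₀ u ν hu₀ hE hν n hn m ε hε
  obtain ⟨Φ, g, s, hΦ, hg, hs⟩ := hE.exists_decoder_velocity hT hu₀
  have hm1 : 1 ≤ max 1 ε⁻¹ := le_max_left _ _
  have hεi : 0 < ε⁻¹ := inv_pos.2 hε
  -- The tolerance for latent states: after the decoder it costs at most `ε / (2 * κ')`, and `e ≤ 1`
  -- keeps the computed states in the ball where the decoder network is accurate.
  set e : ℝ := (D * max 1 ε⁻¹)⁻¹ with he
  have he0 : 0 < e := by positivity
  have he1 : e ≤ 1 := inv_le_one_of_one_le₀ (one_le_mul_of_one_le_of_one_le hD1 hm1)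
  have heε : L * e ≤ ε / (2 * κ') := by
    have h1 : e ≤ ε / D := by
      rw [he, div_eq_mul_inv, ← inv_inv ε, ← mul_inv, mul_comm]
      gcongr
      rw [inv_inv]; exact le_max_right _ _
    calc L * e ≤ (L + 1) * (ε / D) := by gcongr; linarith
      _ = ε / (2 * κ') := by rw [hD]; field_simp
  -- Components beyond `nstar` get target zero. The velocity tolerance `e / (2 * T)` integrates to
  -- `e / 2`; quadrature takes the other half.
  obtain ⟨dyn, hdynW, hdynE⟩ := hdyn (Fin n)
    (fun x i => if h : (i : ℕ) < nstar then g x ⟨i, h⟩ else 0)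
    (fun i x y => by
      split_ifs with h
      · rw [← dist_eq_norm, ← Real.dist_eq]
        exact (dist_le_pi_dist _ _ _).trans (hg.dist_le_mul x y)
      · rw [sub_self, abs_zero]; positivity) (e / (2 * T)) (by positivity)
  obtain ⟨dec, hdecW, hdecE⟩ := hdec (Fin Nh × Fin 1) (fun x v => Φ x v.1)
    (fun i x y => by
      rw [← dist_eq_norm, ← Real.dist_eq]
      exact (dist_le_pi_dist _ _ _).trans (hΦ.dist_le_mul x y)) (ε / (2 * κ')) (by positivity)
  refine ⟨dyn, (dec.padInput n).toGraphDecoder m, ?_, ?_, by simp [FNN.toGraphDecoder], ?_⟩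
  · have h1 := max_one_pow_le (a := ε⁻¹) (b := (e / (2 * T))⁻¹) (D := 2 * T * D) (by positivity)
      (by positivity) (le_of_eq (by rw [he]; field_simp)) (le_refl (d + 1))
    calc (dyn.activeWeights : ℝ) ≤ dyn.size := by exact_mod_cast dyn.activeWeights_le_size
      _ ≤ A₁ * (n * max 1 ((e / (2 * T))⁻¹ ^ (d + 1))) := by simpa using hdynW
      _ ≤ A₁ * (n * ((1 + (2 * T * D) ^ (d + 1)) * max 1 (ε⁻¹ ^ (d + 1)))) := by gcongr
      _ = A₁ * (1 + (2 * T * D) ^ (d + 1)) * (n * max 1 (ε⁻¹ ^ (d + 1))) := by ring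
      _ ≤ _ := by
        gcongr
        exact le_add_of_nonneg_right (by positivity)
  · have h1 := max_one_pow_le (a := ε⁻¹) (b := (ε / (2 * κ'))⁻¹) (D := 2 * κ') (by positivity)
      (by positivity) (by
        rw [inv_div, div_eq_mul_inv]; gcongr; exact le_max_right _ _) hn
    rw [FNN.activeWeights_toGraphDecoder]
    calc ((dec.padInput n).activeWeights : ℝ) ≤ dec.size := by
          exact_mod_cast (dec.activeWeights_padInput hn).trans dec.activeWeights_le_size
      _ ≤ A₂ * (Nh * max 1 ((ε / (2 * κ'))⁻¹ ^ nstar)) := by simpa using hdecW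
      _ ≤ A₂ * (Nh * ((1 + (2 * κ') ^ nstar) * max 1 (ε⁻¹ ^ n))) := by gcongr
      _ = A₂ * (1 + (2 * κ') ^ nstar) * (Nh * max 1 (ε⁻¹ ^ n)) := by ring
      _ ≤ _ := by
        gcongr
        exact le_add_of_nonneg_left (by positivity)
  intro ω hω
  have hpadC : Continuous fun (x : Fin (d + 1) → ℝ) (i : Fin n) =>
      if h : (i : ℕ) < nstar then g x ⟨i, h⟩ else 0 := continuous_pi fun i => by
    split_ifs with h
    · exact (continuous_apply _).comp hg.continuous
    · exact continuous_const
  obtain ⟨N₀, hN₀⟩ := eventually_atTop.1 (hω.eventually_latentState_sub_le hT hP hpadC he0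
    (dyn := dyn) fun μ hμ t ht i => hdynE _ ((pi_norm_le_iff_of_nonneg (by positivity)).2 fun j => by
      refine Fin.cases ?_ (fun j => ?_) j
      · rw [Matrix.cons_val_zero, Real.norm_of_nonneg ht.1]; linarith [ht.2]
      · rw [Matrix.cons_val_succ]
        linarith [norm_le_pi_norm μ j, hρ μ hμ]) i)
  -- A step size of at most `T / (N₀ + 1)` forces `N > N₀`, and the `+ 1` avoids division by zero.
  refine ⟨T / (N₀ + 1), by positivity, fun N hN1 hN μ hμ k hk1 hkN => ?_⟩
  have hNpos : (0 : ℝ) < N := by exact_mod_cast hN1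
  have hNN₀ : N₀ ≤ N := by
    have := (div_le_div_iff_of_pos_left hT hNpos (by positivity)).1 hN
    have : N₀ + 1 ≤ N := by exact_mod_cast this
    omega
  have hlat := hN₀ N hNN₀ μ hμ k hk1 hkN
  have ht : (k : ℝ) * (T / N) ∈ Ioc 0 T := by
    have hk : (0 : ℝ) < k := by exact_mod_cast hk1
    exact ⟨by positivity, (grid_mem_Icc hT.le hkN).2⟩
  obtain ⟨hu, hsR, hsg⟩ := hs μ hμ _ ht
  set t : ℝ := k * (T / N)
  set y : Fin nstar → ℝ := fun j => latentState T ω dyn N k μ (Fin.castLE hn j) with hy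
  have hys : ‖y - s t μ‖ ≤ e := (pi_norm_le_iff_of_nonneg he0.le).2 fun j => by
    have := hlat (Fin.castLE hn j)
    simp only [Fin.val_castLE, Fin.is_lt, dif_pos, Fin.eta, hsg] at this
    exact this
  have hyR : ‖y‖ ≤ 2 * |R| + 1 := by
    have := norm_add_le (y - s t μ) (s t μ)
    rw [sub_add_cancel] at this
    linarith [le_abs_self R]
  have herr : ∀ v, |u t μ v - ((dec.padInput n).toGraphDecoder m).eval G elu
      (latentState T ω dyn N k μ) v 0| ≤ ε / κ' := fun v => by
    rw [FNN.eval_toGraphDecoder G (by simp [elu]), FNN.eval_padInput elu hn, hu]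
    have h1 := hdecE y hyR (v, 0)
    rw [abs_sub_comm] at h1
    have h2 : |Φ (s t μ) v - Φ y v| ≤ ε / (2 * κ') := by
      rw [← Real.dist_eq]
      refine (dist_le_pi_dist _ _ v).trans ((hΦ.dist_le_mul _ _).trans (le_trans ?_ heε))
      rw [dist_comm, dist_eq_norm]
      gcongr
    calc |Φ (s t μ) v - dec.eval elu y (v, 0)| ≤ ε / (2 * κ') + ε / (2 * κ') :=
          (abs_sub_le _ _ _).trans (add_le_add h2 h1)
      _ = ε / κ' := by field_simp; ring
  calc ν _ ≤ κ * ‖_‖ := hν _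
    _ ≤ κ' * (ε / κ') := mul_le_mul (le_max_left _ _)
        ((pi_norm_le_iff_of_nonneg (by positivity)).2 herr) (norm_nonneg _) (by positivity)
    _ = ε := by field_simp

theorem mainTheorem1 {d : ℕ} (T : ℝ) (hT : 0 < T) (P : Set (Fin d → ℝ))
    (hP : Bornology.IsBounded P) (nstar : ℕ) :
    ∃ C : ℝ≥0 → ℝ → ℝ≥0 → ℝ → ℝ,
      ∀ (Nh : ℕ) (G : SimpleGraph (Fin Nh)) [DecidableRel G.Adj]
        (u₀ : Fin Nh → ℝ) (u : ℝ → (Fin d → ℝ) → (Fin Nh → ℝ))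
        (ν : Seminorm ℝ (Fin Nh → ℝ)),
        (∀ μ ∈ P, u 0 μ = u₀) →
        PerfectEmbedding T P u nstar →
        (∃ (K : ℝ≥0) (R : ℝ) (L : ℝ≥0) (κ : ℝ),
          EmbeddingBounds T P u nstar K R L ∧ ∀ x, ν x ≤ κ * ‖x‖) ∧
        ∀ (K : ℝ≥0) (R : ℝ) (L : ℝ≥0) (κ : ℝ),
          EmbeddingBounds T P u nstar K R L → (∀ x, ν x ≤ κ * ‖x‖) →
          ∀ n ≥ nstar, ∀ (m : ℕ), ∀ ε > 0,
            ∃ (dyn : FNN (Fin n) (d + 1)) (dec : GraphDecoder n (Fin Nh) 1),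
              (dyn.activeWeights : ℝ) ≤ C K R L κ * (n * max 1 (ε⁻¹ ^ (d + 1))) ∧
              (dec.activeWeights : ℝ) ≤ C K R L κ * (Nh * max 1 (ε⁻¹ ^ n)) ∧
              dec.convs.length = m ∧
              ∀ ω : ℕ → ℕ → ℕ → ℝ, IsConvergentQuadrature T ω →
                ∃ Δtstar > 0, ∀ N : ℕ, 1 ≤ N → T / N ≤ Δtstar →
                  ∀ μ ∈ P, ∀ k : ℕ, 1 ≤ k → k ≤ N →
                    ν (fun v => u (k * (T / N)) μ v -
                      dec.eval G elu (latentState T ω dyn N k μ) v 0) ≤ ε := by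
  choose C hC using fun K R L κ => exists_weight_constant d hT hP nstar K R L κ
  refine ⟨C, fun Nh G _ u₀ u ν hu₀ hPE => ⟨?_, fun K R L κ hE hν =>
    hC K R L κ Nh G u₀ u ν hu₀ hE hν⟩⟩
  obtain ⟨Φ, f, s, Ψ, hemb⟩ := hPE nstar le_rfl
  obtain ⟨K, R, L, hE⟩ := hemb.exists_embeddingBounds hT hP hu₀
  obtain ⟨κ, hκ⟩ := ν.exists_le_mul_norm
  exact ⟨K, R, L, κ, hE, hκ⟩
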